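/- Let $L>0$, let $m\ge 0$ be an integer and let $$0=t_0<s_0<t_1<s_1<\dots<t_m<s_m=L.$$ Let $a:[0,L]\to[0,\infty)$ be such that, for every $i\in\{0,\dots,m\}$, the restriction of $a$ to $[t_i,s_i]$ is continuous and positive, while $a=0$ on $(s_j,t_{j+1})$ for every $j\in\{0,\dots,m-1\}$. Let $p>0$, $p\neq 1$. For $\lambda\in\mathbb{R}$ consider the problem $$-u''=\lambda u+a(t)|u|^{p-1}u\ \text{ in } [0,L],\qquad u(0)=u(L)=0, \tag{1}$$ where a solution is a function $u\in C^1[0,L]$ with $u'$ absolutely continuous, that satisfies the equation for almost every $t\in[0,L]$ and the boundary conditions. The interior nodes of a solution $u\neq 0$ are its zeros in the open interval $(0,L)$. Put $\sigma_n:=\left(\frac{n\pi}{L}\right)^2$ for every integer $n\ge 1$. Then, for every integer $n\ge 1$ and every $\lambda\in\mathbb{R}$, problem (1) has a solution with exactly $n-1$ interior nodes if and only if $\lambda<\sigma_n$. In that case (1) has at least two solutions of this type: one solution $u$ with $u'(0)>0$, and its opposite $-u$. Consequently: - for every $\lambda<\sigma_1$ and every integer $\kappa\ge 1$, problem (1)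 has at least two solutions with exactly $\kappa-1$ zeros in $(0,L)$; - for all integers $\kappa\ge n\ge 1$ and every $\lambda\in[\sigma_n,\sigma_{n+1})$, problem (1) has at least two solutions with exactly $\kappa$ zeros in $(0,L)$. -/

import Mathlib

open Set

/-- `0 = t₀ < s₀ < t₁ < s₁ < ⋯ < t_m < s_m = L`, and the weight `a` is continuous and positive on
each hump `[tᵢ, sᵢ]` and vanishes on each gap `(sᵢ, tᵢ₊₁)`.  Only the values of `a` on `[0, L]`
matter. -/
structure IsHumpWeight (L : ℝ) (m : ℕ) (t s : Fin (m + 1) → ℝ) (a : ℝ → ℝ) : Prop where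
  start_eq : t 0 = 0
  end_eq : s (Fin.last m) = L
  hump_lt : ∀ i, t i < s i
  gap_lt : ∀ i : Fin m, s i.castSucc < t i.succ
  continuousOn_hump : ∀ i, ContinuousOn a (Icc (t i) (s i))
  pos_hump : ∀ i, ∀ x ∈ Icc (t i) (s i), 0 < a x
  zero_gap : ∀ i : Fin m, ∀ x ∈ Ioo (s i.castSucc) (t i.succ), a x = 0

/-- The derivative of `u` on `[0, L]` (one-sided at the end points). -/
noncomputable def derivOn (L : ℝ) (u : ℝ → ℝ) : ℝ → ℝ := derivWithin u (Icc 0 L)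

/-- `u` is a solution of `-u'' = lam * u + a(x) |u|^(p-1) u` on `[0, L]`, `u(0) = u(L) = 0`, in the
Carathéodory sense: `u` is `C¹` on `[0, L]`, `u'` is absolutely continuous on `[0, L]`, and the
equation holds almost everywhere. Only the values of `u` on `[0, L]` matter. -/
structure IsDirichletSolution (L p : ℝ) (a : ℝ → ℝ) (lam : ℝ) (u : ℝ → ℝ) : Prop where
  contDiffOn : ContDiffOn ℝ 1 u (Icc 0 L)
  absolutelyContinuous : AbsolutelyContinuousOnInterval (derivOn L u) 0 L
  equation : ∀ᵐ x ∂MeasureTheory.volume, x ∈ Ioo 0 L →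
    HasDerivAt (derivOn L u) (-(lam * u x + a x * (|u x| ^ (p - 1) * u x))) x
  left_eq : u 0 = 0
  right_eq : u L = 0

/-- The function `u` has exactly `k` zeros in the open interval `(0, L)`. -/
def HasInteriorNodes (L : ℝ) (u : ℝ → ℝ) (k : ℕ) : Prop :=
  {x ∈ Ioo 0 L | u x = 0}.encard = k

/-- A solution of the boundary value problem with exactly `k` interior nodes. -/
def IsNodalSolution (L p : ℝ) (a : ℝ → ℝ) (lam : ℝ) (k : ℕ) (u : ℝ → ℝ) : Prop :=
  IsDirichletSolution L p a lam u ∧ HasInteriorNodes L u k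

/-- There are at least two different solutions, as functions on `[0, L]`, with exactly `k` interior
nodes. -/
def HasTwoNodalSolutions (L p : ℝ) (a : ℝ → ℝ) (lam : ℝ) (k : ℕ) : Prop :=
  ∃ u v : ℝ → ℝ, IsNodalSolution L p a lam k u ∧ IsNodalSolution L p a lam k v ∧
    ¬ EqOn u v (Icc 0 L)

/-- The `n`-th Dirichlet eigenvalue `(n π / L)²` of `-u''` on `(0, L)`. -/
noncomputable def dirichletEigenvalue (L : ℝ) (n : ℕ) : ℝ := (n * Real.pi / L) ^ 2

/-!
Necessity of `lam < (n π / L)²` is Sturm comparison with the sine. Between two zeros at distance `d`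
a solution has `lam ≤ (π / d)²`, strictly on the first nodal interval because the weight is positive
there (`IsDirichletSolution.lam_le_of_nodal_interval`). So if `lam ≥ (n π / L)²`, each interval of
length `L / n` starting at a zero contains a further one, the first of these in its interior, and
there are at least `n` interior zeros (`IsDirichletSolution.exists_finset_zeros`).

For sufficiency, write `u = exp σ * sin θ`, `u' = exp σ * cos θ`. The angle `θ` crosses multiples of
`π` upwards only, so a solution with `θ 0 = 0` and `θ L = n π` has exactly `n - 1` interior zeros
(`IsPrufer.hasInteriorNodes`). Shooting cannot be applied directly: for a weight that is
merely continuous, initial value problems may fail to be globally solvable (`p > 1`) or uniquely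
solvable (`p < 1`). Therefore the weight is replaced by continuous averages and `|u| ^ (p - 1)` by
smooth bounded functions (`regCoeff`).

* For the regularized problem the Prüfer system has a global flow (`exists_prufer_flow`). If the
  radius `exp σ` is everywhere small, respectively everywhere large, then comparison with harmonic
  oscillators puts `θ L` on one, respectively the other, side of `n π`
  (`exists_angle_dichotomy`). Here `lam < (n π / L)²` bounds the angle on the side where the
  nonlinear term is negligible, and the first hump, where that term dominates, makes the angle
  exceed `n π` on the other side. The intermediate value theorem yields `θ L = n π`.
* On a nodal interval `u'' ≤ |lam| |u|` up to sign, so smallness or boundedness of `|u| + |u'|` at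
  one point propagates over the interval, and hence over all `n` of them
  (`IsPrufer.abs_add_abs_le_iterate_growthBound`). By the dichotomy a solution with `θ L = n π` is
  neither small everywhere nor large everywhere, so its radius lies between two positive constants
  independent of the regularization (`exists_pruferSolution_bounds`).
* These bounds make the angles and the logarithms of the radii equi-Lipschitz, and a uniform limit
  given by the Arzelà–Ascoli theorem solves the original problem
  (`exists_prufer_integral_solution`). The condition `θ L = n π` passes to the limit, and with it
  the number of zeros.
-/

open Filter Topology

/-! ### Prüfer angle and number of zeros -/

/-- `θ` and `σ` are the Prüfer angle and the logarithm of the Prüfer radius, on `[0, L]`, of the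
function `u = exp σ * sin θ`, whose derivative is `exp σ * cos θ`. -/
structure IsPrufer (L : ℝ) (θ σ : ℝ → ℝ) : Prop where
  continuousOn_angle : ContinuousOn θ (Icc 0 L)
  continuousOn_logRadius : ContinuousOn σ (Icc 0 L)
  hasDerivWithinAt : ∀ t ∈ Icc 0 L,
    HasDerivWithinAt (fun s => Real.exp (σ s) * Real.sin (θ s)) (Real.exp (σ t) * Real.cos (θ t))
      (Icc 0 L) t

namespace IsPrufer

variable {L : ℝ} {θ σ : ℝ → ℝ}

/-- At a zero of `u` the angle passes a multiple of `π` in the increasing direction. -/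
lemma eventually_slope_pos (h : IsPrufer L θ σ) {t : ℝ} (ht : t ∈ Icc 0 L) {j : ℤ}
    (hj : θ t = j * Real.pi) :
    ∀ᶠ s in 𝓝[Icc 0 L \ {t}] t, 0 < (s - t) * (θ s - j * Real.pi) := by
  have hc : Real.cos (j * Real.pi) * Real.cos (j * Real.pi) = 1 := by
    have h1 := Real.sin_sq_add_cos_sq (j * Real.pi)
    rw [Real.sin_int_mul_pi] at h1
    linarith
  have hs0 : Real.sin (θ t) = 0 := by rw [hj, Real.sin_int_mul_pi]
  have h1 := ((h.hasDerivWithinAt t ht).mul_const (Real.cos (j * Real.pi)))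
  rw [hasDerivWithinAt_iff_tendsto_slope] at h1
  have hpos : 0 < Real.exp (σ t) * Real.cos (θ t) * Real.cos (j * Real.pi) := by
    rw [hj, mul_assoc, hc, mul_one]
    exact Real.exp_pos _
  have h2 := h1.eventually (lt_mem_nhds hpos)
  have h3 : ∀ᶠ s in 𝓝[Icc 0 L \ {t}] t, |θ s - θ t| < Real.pi := by
    have := (h.continuousOn_angle t ht).mono (sdiff_subset : Icc 0 L \ {t} ⊆ Icc 0 L)
    exact (Metric.tendsto_nhds.1 this Real.pi Real.pi_pos)
  filter_upwards [h2, h3, self_mem_nhdsWithin] with s hs1 hs2 hs3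
  have hne : s - t ≠ 0 := sub_ne_zero.2 hs3.2
  rw [slope_def_field, hs0] at hs1
  have hsin : Real.sin (θ s - j * Real.pi) = Real.sin (θ s) * Real.cos (j * Real.pi) := by
    rw [Real.sin_sub, Real.sin_int_mul_pi]; ring
  have hs4 : 0 < (s - t) * Real.sin (θ s - j * Real.pi) := by
    have h5 := mul_pos hs1 (mul_pos (mul_self_pos.2 hne) (Real.exp_pos (-σ s)))
    have h6 : Real.exp (σ s) * Real.exp (-σ s) = 1 := by
      rw [← Real.exp_add]; simp
    have : (s - t) * Real.sin (θ s - j * Real.pi) =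
        (Real.exp (σ s) * Real.sin (θ s) * Real.cos (j * Real.pi) -
          Real.exp (σ t) * 0 * Real.cos (j * Real.pi)) / (s - t) *
          ((s - t) * (s - t) * Real.exp (-σ s)) := by
      rw [hsin]
      field_simp
      linear_combination -(Real.sin (θ s) * Real.cos (j * Real.pi)) * h6
    rwa [this]
  rw [hj, abs_lt] at hs2
  rcases lt_or_gt_of_ne hne with hlt | hgt
  · have h7 : Real.sin (θ s - j * Real.pi) < 0 := by
      by_contra! hcon
      exact absurd hs4 (not_lt.2 (mul_nonpos_of_nonpos_of_nonneg hlt.le hcon))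
    refine mul_pos_of_neg_of_neg hlt ?_
    by_contra! hcon
    exact absurd h7 (not_lt.2 (Real.sin_nonneg_of_nonneg_of_le_pi hcon hs2.2.le))
  · have h7 : 0 < Real.sin (θ s - j * Real.pi) := pos_of_mul_pos_right hs4 hgt.le
    refine mul_pos hgt ?_
    by_contra! hcon
    exact absurd h7 (not_lt.2 (Real.sin_nonpos_of_nonpos_of_neg_pi_le hcon (by linarith)))

/-- The angle never returns to a multiple of `π` that it has reached. -/
lemma int_mul_pi_lt (h : IsPrufer L θ σ) {x y : ℝ} (hx : 0 ≤ x) (hxy : x < y) (hy : y ≤ L)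
    {j : ℤ} (hj : j * Real.pi ≤ θ x) : j * Real.pi < θ y := by
  by_contra! hle
  -- After `x` the angle exceeds `j * π` at some point `x'`; the first later point where it does
  -- not exceed `j * π` would be a downward passage.
  obtain ⟨x', hx', hlt⟩ : ∃ x' ∈ Ico x y, j * Real.pi < θ x' := by
    rcases hj.lt_or_eq with hj | hj
    · exact ⟨x, ⟨le_rfl, hxy⟩, hj⟩
    · have h1 := h.eventually_slope_pos ⟨hx, hxy.le.trans hy⟩ hj.symm
      have h2 : 𝓝[Ioo x y] x ≤ 𝓝[Icc 0 L \ {x}] x := by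
        refine nhdsWithin_mono _ fun s hs => ⟨⟨hx.trans hs.1.le, hs.2.le.trans hy⟩, hs.1.ne'⟩
      have h3 : (𝓝[Ioo x y] x).NeBot := by
        rw [nhdsWithin_Ioo_eq_nhdsGT hxy]; infer_instance
      obtain ⟨s, hs1, hs2⟩ := ((h1.filter_mono h2).and self_mem_nhdsWithin).exists
      refine ⟨s, ⟨hs2.1.le, hs2.2⟩, ?_⟩
      have := pos_of_mul_pos_right hs1 (sub_nonneg.2 hs2.1.le)
      linarith
  have hcont : ContinuousOn θ (Icc x' y) :=
    h.continuousOn_angle.mono (Icc_subset_Icc (hx.trans hx'.1) hy)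
  set T := Icc x' y ∩ θ ⁻¹' Iic (j * Real.pi)
  have hTc : IsClosed T := hcont.preimage_isClosed_of_isClosed isClosed_Icc isClosed_Iic
  have hTn : T.Nonempty := ⟨y, ⟨hx'.2.le, le_rfl⟩, hle⟩
  have hTb : BddBelow T := ⟨x', fun s hs => hs.1.1⟩
  have hm := hTc.csInf_mem hTn hTb
  set w := sInf T
  have hxw : x' < w := by
    refine lt_of_le_of_ne hm.1.1 fun he => ?_
    have := hm.2
    rw [← he] at this
    exact absurd hlt (not_lt.2 this)
  have hlow : ∀ s ∈ Ico x' w, j * Real.pi < θ s := by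
    intro s hs
    by_contra! hcon
    exact absurd (csInf_le hTb (show s ∈ T from ⟨⟨hs.1, hs.2.le.trans hm.1.2⟩, hcon⟩))
      (not_le.2 hs.2)
  have hwL : w ∈ Icc 0 L := ⟨(hx.trans hx'.1).trans hxw.le, hm.1.2.trans hy⟩
  have hNB : (𝓝[Ioo x' w] w).NeBot := by
    rw [nhdsWithin_Ioo_eq_nhdsLT hxw]; infer_instance
  have hsub : 𝓝[Ioo x' w] w ≤ 𝓝[Icc 0 L \ {w}] w :=
    nhdsWithin_mono _ fun s hs =>
      ⟨⟨(hx.trans hx'.1).trans hs.1.le, hs.2.le.trans hwL.2⟩, hs.2.ne⟩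
  have hweq : θ w = j * Real.pi := by
    refine le_antisymm hm.2 ?_
    have ht : Tendsto θ (𝓝[Ioo x' w] w) (𝓝 (θ w)) :=
      (h.continuousOn_angle w hwL).mono_left
        (hsub.trans (nhdsWithin_mono _ sdiff_subset))
    refine ge_of_tendsto ht ?_
    filter_upwards [self_mem_nhdsWithin] with s hs using (hlow s ⟨hs.1.le, hs.2⟩).le
  obtain ⟨s, hs1, hs2⟩ :=
    (((h.eventually_slope_pos hwL hweq).filter_mono hsub).and self_mem_nhdsWithin).exists
  have h8 := hlow s ⟨hs2.1.le, hs2.2⟩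
  exact absurd hs1 (not_lt.2 (mul_nonpos_of_nonpos_of_nonneg (by linarith [hs2.2]) (by linarith)))

lemma int_mul_pi_le (h : IsPrufer L θ σ) {x y : ℝ} (hx : 0 ≤ x) (hxy : x ≤ y) (hy : y ≤ L)
    {j : ℤ} (hj : j * Real.pi ≤ θ x) : j * Real.pi ≤ θ y := by
  rcases hxy.lt_or_eq with hlt | rfl
  · exact (h.int_mul_pi_lt hx hlt hy hj).le
  · exact hj

lemma le_int_mul_pi (h : IsPrufer L θ σ) {x y : ℝ} (hx : 0 ≤ x) (hxy : x ≤ y) (hy : y ≤ L)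
    {j : ℤ} (hj : θ y ≤ j * Real.pi) : θ x ≤ j * Real.pi := by
  rcases hxy.lt_or_eq with hlt | rfl
  · by_contra! hcon
    exact absurd (h.int_mul_pi_lt hx hlt hy hcon.le) (not_lt.2 hj)
  · exact hj

/-- The number of interior zeros of `u` is read off from the angle at the right end point. -/
lemma hasInteriorNodes (h : IsPrufer L θ σ) (hL : 0 < L) {n : ℕ} (h0 : θ 0 = 0)
    (hθL : θ L = n * Real.pi) :
    HasInteriorNodes L (fun s => Real.exp (σ s) * Real.sin (θ s)) (n - 1) := by
  have hex : ∀ j : ℕ, ∃ x, j ∈ Ioo 0 n → x ∈ Ioo 0 L ∧ θ x = j * Real.pi := by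
    intro j
    by_cases hj : j ∈ Ioo 0 n
    · have h1 : (j : ℝ) * Real.pi ∈ Ioo (θ 0) (θ L) := by
        rw [h0, hθL]
        have h2 : (0 : ℝ) < j := by exact_mod_cast hj.1
        have h3 : (j : ℝ) < n := by exact_mod_cast hj.2
        exact ⟨mul_pos h2 Real.pi_pos, mul_lt_mul_of_pos_right h3 Real.pi_pos⟩
      obtain ⟨x, hx, hxe⟩ := intermediate_value_Ioo hL.le h.continuousOn_angle h1
      exact ⟨x, fun _ => ⟨hx, hxe⟩⟩
    · exact ⟨0, fun h' => absurd h' hj⟩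
  choose z hz using hex
  have hset : {x ∈ Ioo 0 L | Real.exp (σ x) * Real.sin (θ x) = 0} = z '' Ioo 0 n := by
    ext x
    constructor
    · rintro ⟨hx, hx0⟩
      have hsin : Real.sin (θ x) = 0 := (mul_eq_zero.1 hx0).resolve_left (Real.exp_pos _).ne'
      obtain ⟨j, hj⟩ := Real.sin_eq_zero_iff.1 hsin
      have hj0 : 0 < j := by
        have h1 := h.int_mul_pi_lt (j := 0) le_rfl hx.1 hx.2.le (by simp [h0])
        rw [← hj] at h1
        exact_mod_cast lt_of_mul_lt_mul_right h1 Real.pi_pos.le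
      have hjn : j < n := by
        have h1 := h.int_mul_pi_lt (j := j) hx.1.le hx.2 le_rfl hj.le
        rw [hθL] at h1
        exact_mod_cast lt_of_mul_lt_mul_right h1 Real.pi_pos.le
      lift j to ℕ using hj0.le
      have hjm : j ∈ Ioo 0 n := ⟨by exact_mod_cast hj0, by exact_mod_cast hjn⟩
      refine ⟨j, hjm, ?_⟩
      obtain ⟨hz1, hz2⟩ := hz j hjm
      have hj' : θ x = ((j : ℤ) : ℝ) * Real.pi := hj.symm
      rcases lt_trichotomy (z j) x with hlt | heq | hgt
      · have := h.int_mul_pi_lt (j := j) hz1.1.le hlt hx.2.le (by simp [hz2])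
        exact absurd this (by rw [hj']; exact lt_irrefl _)
      · exact heq
      · have := h.int_mul_pi_lt (j := j) hx.1.le hgt hz1.2.le hj'.ge
        exact absurd this (by rw [hz2]; simp)
    · rintro ⟨j, hj, rfl⟩
      obtain ⟨hz1, hz2⟩ := hz j hj
      exact ⟨hz1, by rw [hz2, Real.sin_nat_mul_pi, mul_zero]⟩
  have hinj : InjOn z (Ioo 0 n) := by
    intro i hi j hj hij
    have h1 := (hz i hi).2
    rw [hij, (hz j hj).2] at h1
    exact_mod_cast (mul_right_cancel₀ Real.pi_pos.ne' h1).symm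
  rw [HasInteriorNodes, hset, hinj.encard_image, ← Finset.coe_Ioo, Set.encard_coe_eq_coe_finsetCard]
  simp

end IsPrufer

/-! ### Comparison for the angle equation -/

lemma sub_le_mul_sub_of_hasDerivAt_le {f f' : ℝ → ℝ} {x y C : ℝ} (hxy : x ≤ y)
    (hf : ∀ t ∈ Icc x y, HasDerivAt f (f' t) t) (hC : ∀ t ∈ Icc x y, f' t ≤ C) :
    f y - f x ≤ C * (y - x) := by
  refine (convex_Icc x y).image_sub_le_mul_sub_of_deriv_le
    (fun t ht => (hf t ht).continuousAt.continuousWithinAt) ?_ ?_ x ⟨le_rfl, hxy⟩ y ⟨hxy, le_rfl⟩ hxy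
  · intro t ht
    exact (hf t (interior_subset ht)).differentiableAt.differentiableWithinAt
  · intro t ht
    rw [(hf t (interior_subset ht)).deriv]
    exact hC t (interior_subset ht)

/-- The continuous branch, vanishing at `0`, of `θ ↦ arctan (c * tan θ)`. -/
noncomputable def stretchAngle (c θ : ℝ) : ℝ :=
  θ + Real.arctan ((c - 1) * (Real.sin θ * Real.cos θ) / (Real.cos θ ^ 2 + c * Real.sin θ ^ 2))

lemma cos_sq_add_mul_sin_sq_pos {c : ℝ} (hc : 0 < c) (θ : ℝ) :
    0 < Real.cos θ ^ 2 + c * Real.sin θ ^ 2 := by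
  have h := Real.sin_sq_add_cos_sq θ
  rcases le_total c 1 with h1 | h1
  · nlinarith [sq_nonneg (Real.sin θ), sq_nonneg (Real.cos θ)]
  · nlinarith [sq_nonneg (Real.sin θ), sq_nonneg (Real.cos θ)]

lemma hasDerivAt_stretchAngle {c : ℝ} (hc : 0 < c) (θ : ℝ) :
    HasDerivAt (stretchAngle c) (c / (Real.cos θ ^ 2 + c ^ 2 * Real.sin θ ^ 2)) θ := by
  have hD := cos_sq_add_mul_sin_sq_pos hc θ
  have hD2 := cos_sq_add_mul_sin_sq_pos (pow_pos hc 2) θ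
  have hs := Real.hasDerivAt_sin θ
  have hk := Real.hasDerivAt_cos θ
  have hN := (hs.mul hk).const_mul (c - 1)
  have hDd := (hk.pow 2).add ((hs.pow 2).const_mul c)
  have h := (hasDerivAt_id θ).add ((hN.div hDd hD.ne').arctan)
  refine h.congr_deriv ?_
  simp only [Pi.mul_apply, Pi.add_apply, Pi.pow_apply, Pi.div_apply]
  have h1 := Real.sin_sq_add_cos_sq θ
  set s := Real.sin θ
  set k := Real.cos θ
  have hden : 1 + ((c - 1) * (s * k) / (k ^ 2 + c * s ^ 2)) ^ 2 =
      (k ^ 2 + c ^ 2 * s ^ 2) / (k ^ 2 + c * s ^ 2) ^ 2 := by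
    field_simp
    linear_combination (k ^ 2 + c ^ 2 * s ^ 2) * h1
  rw [hden]
  field_simp
  push_cast
  have : k ^ 2 = 1 - s ^ 2 := by linarith
  grind

lemma stretchAngle_strictMono {c : ℝ} (hc : 0 < c) : StrictMono (stretchAngle c) := by
  refine strictMono_of_deriv_pos fun θ => ?_
  rw [(hasDerivAt_stretchAngle hc θ).deriv]
  exact div_pos hc (cos_sq_add_mul_sin_sq_pos (pow_pos hc 2) θ)

@[simp]
lemma stretchAngle_nat_mul_pi (c : ℝ) (n : ℕ) :
    stretchAngle c (n * Real.pi) = n * Real.pi := by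
  simp [stretchAngle, Real.sin_nat_mul_pi]

@[simp]
lemma stretchAngle_zero (c : ℝ) : stretchAngle c 0 = 0 := by
  simp [stretchAngle]

/-- An angle that turns no faster than that of a harmonic oscillator stays below the oscillator's
angle. -/
lemma angle_lt_of_deriv_le {α c L : ℝ} {θ θ' : ℝ → ℝ} {n : ℕ} (hL : 0 ≤ L) (hc : 0 < c)
    (hθ : ∀ t ∈ Icc 0 L, HasDerivAt θ (θ' t) t) (h0 : θ 0 = 0)
    (hle : ∀ t ∈ Icc 0 L, θ' t ≤ α * (Real.cos (θ t) ^ 2 + c ^ 2 * Real.sin (θ t) ^ 2))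
    (hn : α * c * L < n * Real.pi) : θ L < n * Real.pi := by
  have h1 := sub_le_mul_sub_of_hasDerivAt_le (C := α * c) hL
    (fun t ht => (hasDerivAt_stretchAngle hc (θ t)).comp t (hθ t ht)) (fun t ht => by
      have hp := cos_sq_add_mul_sin_sq_pos (pow_pos hc 2) (θ t)
      rw [div_mul_eq_mul_div, div_le_iff₀ hp]
      calc c * θ' t ≤ c * _ := mul_le_mul_of_nonneg_left (hle t ht) hc.le
        _ = _ := by ring)
  simp only [Function.comp_apply, h0, stretchAngle_zero, sub_zero] at h1
  rw [← (stretchAngle_strictMono hc).lt_iff_lt, stretchAngle_nat_mul_pi]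
  exact h1.trans_lt hn

/-- An angle that turns no slower than that of a harmonic oscillator stays above the oscillator's
angle. -/
lemma le_angle_of_le_deriv {α c h : ℝ} {θ θ' : ℝ → ℝ} {n : ℕ} (hh : 0 ≤ h) (hc : 0 < c)
    (hθ : ∀ t ∈ Icc 0 h, HasDerivAt θ (θ' t) t) (h0 : θ 0 = 0)
    (hle : ∀ t ∈ Icc 0 h, α * (Real.cos (θ t) ^ 2 + c ^ 2 * Real.sin (θ t) ^ 2) ≤ θ' t)
    (hn : n * Real.pi ≤ α * c * h) : n * Real.pi ≤ θ h := by
  have h1 := sub_le_mul_sub_of_hasDerivAt_le (C := -(α * c)) hh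
    (fun t ht => ((hasDerivAt_stretchAngle hc (θ t)).comp t (hθ t ht)).neg) (fun t ht => by
      have hp := cos_sq_add_mul_sin_sq_pos (pow_pos hc 2) (θ t)
      rw [div_mul_eq_mul_div, neg_le_neg_iff, le_div_iff₀ hp]
      calc _ = c * (α * (Real.cos (θ t) ^ 2 + c ^ 2 * Real.sin (θ t) ^ 2)) := by ring
        _ ≤ _ := mul_le_mul_of_nonneg_left (hle t ht) hc.le)
  simp only [Pi.neg_apply, Function.comp_apply, h0, stretchAngle_zero, sub_zero, neg_zero] at h1
  rw [← (stretchAngle_strictMono hc).le_iff_le, stretchAngle_nat_mul_pi]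
  linarith

/-! ### Propagation of bounds along nodal intervals -/

/-- If `|u| + |u'| ≤ r` at one point of a nodal interval of a solution, then
`|u| + |u'| ≤ growthBound lam A L Ψ r` on the whole nodal interval. -/
noncomputable def growthBound (lam A L : ℝ) (Ψ : ℝ → ℝ) (r : ℝ) : ℝ :=
  Real.exp ((1 + |lam|) * L) * (1 + L) * r + r +
    L * (|lam| * (Real.exp ((1 + |lam|) * L) * (1 + L) * r) +
      A * Ψ (Real.exp ((1 + |lam|) * L) * (1 + L) * r))

section Propagation

variable {lam A L : ℝ} {Ψ : ℝ → ℝ}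

lemma le_growthBound (hA : 0 ≤ A) (hL : 0 ≤ L) (hΨ : ∀ r, 0 ≤ r → 0 ≤ Ψ r) {r : ℝ} (hr : 0 ≤ r) :
    r ≤ growthBound lam A L Ψ r := by
  have hC : 0 ≤ Real.exp ((1 + |lam|) * L) * (1 + L) * r := by positivity
  have := hΨ _ hC
  rw [growthBound]
  have : 0 ≤ L * (|lam| * (Real.exp ((1 + |lam|) * L) * (1 + L) * r) +
      A * Ψ (Real.exp ((1 + |lam|) * L) * (1 + L) * r)) := by positivity
  linarith

lemma growthBound_mono (hA : 0 ≤ A) (hL : 0 ≤ L) (hΨ : MonotoneOn Ψ (Ici 0)) {r s : ℝ}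
    (hr : 0 ≤ r) (hrs : r ≤ s) : growthBound lam A L Ψ r ≤ growthBound lam A L Ψ s := by
  have hC : 0 ≤ Real.exp ((1 + |lam|) * L) * (1 + L) := by positivity
  have h1 : Real.exp ((1 + |lam|) * L) * (1 + L) * r ≤ Real.exp ((1 + |lam|) * L) * (1 + L) * s :=
    mul_le_mul_of_nonneg_left hrs hC
  have h2 := hΨ (mul_nonneg hC hr) (mul_nonneg hC (hr.trans hrs)) h1
  rw [growthBound, growthBound]
  gcongr

lemma continuous_growthBound (hΨ : Continuous Ψ) : Continuous (growthBound lam A L Ψ) := by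
  unfold growthBound
  fun_prop

lemma growthBound_zero (hΨ : Ψ 0 = 0) : growthBound lam A L Ψ 0 = 0 := by
  simp [growthBound, hΨ]

lemma le_growthBound_of_nonneg (hA : 0 ≤ A) (hΨ : MonotoneOn Ψ (Ici 0))
    (hΨ0 : ∀ r, 0 ≤ r → 0 ≤ Ψ r) {u v q : ℝ → ℝ} {x y : ℝ} (hxy : x ≤ y) (hL : y - x ≤ L)
    (hu : ∀ t ∈ Icc x y, HasDerivAt u (v t) t)
    (hv : ∀ t ∈ Icc x y, HasDerivAt v (-((lam + q t) * u t)) t)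
    (hq : ∀ t ∈ Icc x y, 0 ≤ q t) (hqΨ : ∀ t ∈ Icc x y, q t * |u t| ≤ A * Ψ |u t|)
    (hpos : ∀ t ∈ Icc x y, 0 ≤ u t) :
    |u y| + |v y| ≤ growthBound lam A L Ψ (|u x| + |v x|) := by
  set r := |u x| + |v x| with hr
  set c := 1 + |lam| with hc
  have hr0 : 0 ≤ r := by positivity
  have hL0 : 0 ≤ L := (sub_nonneg.2 hxy).trans hL
  have hc1 : 1 ≤ c := by rw [hc]; linarith [abs_nonneg lam]
  have hux : |u x| ≤ r := by rw [hr]; linarith [abs_nonneg (v x)]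
  have hvx : |v x| ≤ r := by rw [hr]; linarith [abs_nonneg (u x)]
  have hexp : ∀ t, HasDerivAt (fun s => Real.exp (c * (s - x))) (c * Real.exp (c * (t - x))) t := by
    intro t
    have := ((((hasDerivAt_id t).sub_const x).const_mul c)).exp
    simpa [mul_comm] using this
  have hexpn : ∀ t, HasDerivAt (fun s => Real.exp (-(c * (s - x))))
      (-c * Real.exp (-(c * (t - x)))) t := by
    intro t
    have := ((((hasDerivAt_id t).sub_const x).const_mul c)).neg.exp
    simpa [mul_comm] using this
  -- `u'' ≤ c² u` makes `exp (c (t - x)) * (u' - c u)` nonincreasing.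
  have hg : ∀ t ∈ Icc x y, Real.exp (c * (t - x)) * (v t - c * u t) ≤ r := by
    intro t ht
    have hsub : Icc x t ⊆ Icc x y := Icc_subset_Icc_right ht.2
    have h1 := sub_le_mul_sub_of_hasDerivAt_le (C := 0) ht.1
      (fun s hs => (hexp s).mul ((hv s (hsub hs)).sub ((hu s (hsub hs)).const_mul c)))
      (fun s hs => by
        have hp := hpos s (hsub hs)
        have hqs := hq s (hsub hs)
        have hl : -lam ≤ |lam| := neg_le_abs lam
        have : c * Real.exp (c * (s - x)) * (v s - c * u s) +
            Real.exp (c * (s - x)) * (-((lam + q s) * u s) - c * v s) =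
            -(Real.exp (c * (s - x)) * ((lam + q s + c ^ 2) * u s)) := by ring
        have h5 : 0 ≤ lam + q s + c ^ 2 := by nlinarith
        have h6 : 0 ≤ Real.exp (c * (s - x)) * ((lam + q s + c ^ 2) * u s) := by positivity
        simp only [Pi.sub_apply]
        linarith)
    have h0 := hpos x ⟨le_rfl, hxy⟩
    simp only [Pi.mul_apply, Pi.sub_apply, sub_self, mul_zero, Real.exp_zero, one_mul,
      zero_mul] at h1
    have := le_abs_self (v x)
    nlinarith
  have hub : ∀ t ∈ Icc x y, u t ≤ Real.exp (c * L) * (1 + L) * r := by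
    intro t ht
    have hsub : Icc x t ⊆ Icc x y := Icc_subset_Icc_right ht.2
    have h1 := sub_le_mul_sub_of_hasDerivAt_le (C := r) ht.1
      (fun s hs => (hexpn s).mul (hu s (hsub hs)))
      (fun s hs => by
        have h2 := hg s (hsub hs)
        have h3 : Real.exp (c * (s - x)) * Real.exp (-(c * (s - x))) = 1 := by
          rw [← Real.exp_add]; simp
        have h4 : Real.exp (-(c * (s - x))) ≤ 1 :=
          Real.exp_le_one_iff.2 (neg_nonpos.2 (mul_nonneg (by linarith) (sub_nonneg.2 hs.1)))
        have h5 := Real.exp_pos (-(c * (s - x)))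
        calc -c * Real.exp (-(c * (s - x))) * u s + Real.exp (-(c * (s - x))) * v s
            = Real.exp (c * (s - x)) * (v s - c * u s) *
                (Real.exp (-(c * (s - x))) * Real.exp (-(c * (s - x)))) := by
              linear_combination -(Real.exp (-(c * (s - x))) * (v s - c * u s)) * h3
          _ ≤ r * (Real.exp (-(c * (s - x))) * Real.exp (-(c * (s - x)))) := by gcongr
          _ ≤ r * (1 * 1) := by gcongr
          _ = r := by ring)
    simp only [Pi.mul_apply, sub_self, mul_zero, neg_zero, Real.exp_zero, one_mul] at h1
    have h2 : Real.exp (-(c * (t - x))) * u t ≤ (1 + L) * r := by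
      have := le_abs_self (u x)
      have : r * (t - x) ≤ r * L := mul_le_mul_of_nonneg_left (by linarith [ht.2]) hr0
      linarith
    calc u t = Real.exp (c * (t - x)) * (Real.exp (-(c * (t - x))) * u t) := by
          rw [← mul_assoc, ← Real.exp_add]; simp
      _ ≤ Real.exp (c * L) * ((1 + L) * r) := by
          gcongr
          · exact mul_nonneg (Real.exp_pos _).le (hpos t ht)
          · linarith [ht.2]
      _ = _ := by ring
  set R := Real.exp (c * L) * (1 + L) * r with hR
  have hR0 : 0 ≤ R := by positivity
  have hm : ∀ t ∈ Icc x y, |(lam + q t) * u t| ≤ |lam| * R + A * Ψ R := by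
    intro t ht
    have h1 := hub t ht
    have h2 : |u t| ≤ R := by rwa [abs_of_nonneg (hpos t ht)]
    rw [abs_mul]
    calc |lam + q t| * |u t| ≤ (|lam| + |q t|) * |u t| := by gcongr; exact abs_add_le _ _
      _ = |lam| * |u t| + q t * |u t| := by rw [abs_of_nonneg (hq t ht)]; ring
      _ ≤ |lam| * R + A * Ψ |u t| :=
          add_le_add (mul_le_mul_of_nonneg_left h2 (abs_nonneg _)) (hqΨ t ht)
      _ ≤ |lam| * R + A * Ψ R := by
          have := hΨ (mem_Ici.2 (abs_nonneg (u t))) (mem_Ici.2 hR0) h2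
          gcongr
  have hm0 : 0 ≤ |lam| * R + A * Ψ R := by have := hΨ0 R hR0; positivity
  have h1 := sub_le_mul_sub_of_hasDerivAt_le (C := |lam| * R + A * Ψ R) hxy hv
    (fun t ht => (abs_le.1 (by simpa using hm t ht)).2)
  have h2 := sub_le_mul_sub_of_hasDerivAt_le (C := |lam| * R + A * Ψ R) hxy
    (fun t ht => (hv t ht).neg)
    (fun t ht => by simpa using (le_abs_self _).trans (hm t ht))
  have h3 : (|lam| * R + A * Ψ R) * (y - x) ≤ (|lam| * R + A * Ψ R) * L :=
    mul_le_mul_of_nonneg_left hL hm0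
  have h4 : |v y| ≤ r + L * (|lam| * R + A * Ψ R) := by
    simp only [Pi.neg_apply] at h2
    rw [abs_le] at hvx ⊢
    constructor <;> linarith [hvx.1, hvx.2]
  have h5 : |u y| ≤ R := by
    rw [abs_of_nonneg (hpos y ⟨hxy, le_rfl⟩)]
    exact hub y ⟨hxy, le_rfl⟩
  rw [growthBound]
  linarith

/-- The bound of `growthBound` propagates forwards and backwards over an interval on which the
solution has constant sign. -/
lemma le_growthBound_of_sign (hA : 0 ≤ A) (hΨ : MonotoneOn Ψ (Ici 0))
    (hΨ0 : ∀ r, 0 ≤ r → 0 ≤ Ψ r) {u v q : ℝ → ℝ} {x y e : ℝ} (hxy : x ≤ y) (hL : y - x ≤ L)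
    (hu : ∀ t ∈ Icc x y, HasDerivAt u (v t) t)
    (hv : ∀ t ∈ Icc x y, HasDerivAt v (-((lam + q t) * u t)) t)
    (hq : ∀ t ∈ Icc x y, 0 ≤ q t) (hqΨ : ∀ t ∈ Icc x y, q t * |u t| ≤ A * Ψ |u t|)
    (he : |e| = 1) (hpos : ∀ t ∈ Icc x y, 0 ≤ e * u t) :
    |u y| + |v y| ≤ growthBound lam A L Ψ (|u x| + |v x|) ∧
      |u x| + |v x| ≤ growthBound lam A L Ψ (|u y| + |v y|) := by
  have hae : ∀ z, |e * z| = |z| := fun z => by rw [abs_mul, he, one_mul]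
  constructor
  · have := le_growthBound_of_nonneg (lam := lam) (L := L) (u := fun t => e * u t)
      (v := fun t => e * v t) (q := q) hA hΨ hΨ0 hxy hL (fun t ht => (hu t ht).const_mul e)
      (fun t ht => ((hv t ht).const_mul e).congr_deriv (by ring)) hq
      (fun t ht => by rw [hae]; exact hqΨ t ht) hpos
    simpa only [hae] using this
  · have hmem : ∀ t ∈ Icc (-y) (-x), -t ∈ Icc x y := fun t ht =>
      ⟨by linarith [ht.2], by linarith [ht.1]⟩
    have := le_growthBound_of_nonneg (lam := lam) (L := L) (u := fun t => e * u (-t))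
      (v := fun t => -(e * v (-t))) (q := fun t => q (-t)) (x := -y) (y := -x) hA hΨ hΨ0
      (by linarith) (by linarith)
      (fun t ht => (((hu _ (hmem t ht)).scomp t (hasDerivAt_neg t)).const_mul e).congr_deriv
        (by simp))
      (fun t ht => ((((hv _ (hmem t ht)).scomp t (hasDerivAt_neg t)).const_mul e).neg).congr_deriv
        (by simp; ring))
      (fun t ht => hq _ (hmem t ht))
      (fun t ht => by rw [hae]; exact hqΨ _ (hmem t ht)) (fun t ht => hpos _ (hmem t ht))
    simpa only [hae, neg_neg, abs_neg] using this

end Propagation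

namespace IsPrufer

variable {L lam A : ℝ} {Ψ θ σ q : ℝ → ℝ}

lemma abs_add_abs_le_iterate_growthBound_aux (h : IsPrufer L θ σ) (hL : 0 ≤ L)
    (hA : 0 ≤ A)
    (hΨ : MonotoneOn Ψ (Ici 0)) (hΨ0 : ∀ r, 0 ≤ r → 0 ≤ Ψ r) {u v : ℝ → ℝ}
    (huθ : ∀ t, u t = Real.exp (σ t) * Real.sin (θ t))
    (hu : ∀ t ∈ Icc 0 L, HasDerivAt u (v t) t)
    (hv : ∀ t ∈ Icc 0 L, HasDerivAt v (-((lam + q t) * u t)) t)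
    (hq : ∀ t ∈ Icc 0 L, 0 ≤ q t) (hqΨ : ∀ t ∈ Icc 0 L, q t * |u t| ≤ A * Ψ |u t|) (N : ℕ) :
    ∀ (j : ℕ) (x y : ℝ), 0 ≤ x → x ≤ y → y ≤ L → j * Real.pi ≤ θ x →
      θ y ≤ (j + N + 1 : ℕ) * Real.pi →
      |u y| + |v y| ≤ (growthBound lam A L Ψ)^[N + 1] (|u x| + |v x|) ∧
        |u x| + |v x| ≤ (growthBound lam A L Ψ)^[N + 1] (|u y| + |v y|) := by
  have hstep : ∀ (j : ℕ) (x y : ℝ), 0 ≤ x → x ≤ y → y ≤ L → j * Real.pi ≤ θ x →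
      θ y ≤ (j + 1 : ℕ) * Real.pi →
      |u y| + |v y| ≤ growthBound lam A L Ψ (|u x| + |v x|) ∧
        |u x| + |v x| ≤ growthBound lam A L Ψ (|u y| + |v y|) := by
    intro j x y hx hxy hy hjx hjy
    have hsub : Icc x y ⊆ Icc 0 L := Icc_subset_Icc hx hy
    refine le_growthBound_of_sign (e := Real.cos (j * Real.pi)) hA hΨ hΨ0 hxy (by linarith)
      (fun t ht => hu t (hsub ht)) (fun t ht => hv t (hsub ht)) (fun t ht => hq t (hsub ht))
      (fun t ht => hqΨ t (hsub ht)) (by simpa using Real.abs_cos_int_mul_pi j) fun t ht => ?_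
    have h1 : j * Real.pi ≤ θ t := by
      simpa using h.int_mul_pi_le (j := j) hx ht.1 (ht.2.trans hy) (by simpa using hjx)
    have h2 : θ t ≤ (j + 1 : ℕ) * Real.pi := by
      simpa using h.le_int_mul_pi (j := (j + 1 : ℕ)) (hx.trans ht.1) ht.2 hy (by simpa using hjy)
    have h3 : Real.sin (θ t - j * Real.pi) = Real.cos (j * Real.pi) * Real.sin (θ t) := by
      rw [Real.sin_sub, Real.sin_nat_mul_pi]; ring
    have h4 : 0 ≤ Real.sin (θ t - j * Real.pi) := by
      refine Real.sin_nonneg_of_nonneg_of_le_pi (by linarith) ?_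
      push_cast at h2
      linarith
    rw [huθ, mul_left_comm, ← h3]
    exact mul_nonneg (Real.exp_pos _).le h4
  have hS : ∀ t, 0 ≤ |u t| + |v t| := fun t => by positivity
  have hge : ∀ (k : ℕ) (r : ℝ), 0 ≤ r → r ≤ (growthBound lam A L Ψ)^[k] r := by
    intro k
    induction k with
    | zero => intro r _; simp
    | succ k ih =>
      intro r hr
      rw [Function.iterate_succ_apply']
      exact (ih r hr).trans (le_growthBound hA hL hΨ0 (hr.trans (ih r hr)))
  have hmono : ∀ (k : ℕ) (r s : ℝ), 0 ≤ r → r ≤ s →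
      (growthBound lam A L Ψ)^[k] r ≤ (growthBound lam A L Ψ)^[k] s := by
    intro k
    induction k with
    | zero => intro r s _ hrs; simpa
    | succ k ih =>
      intro r s hr hrs
      rw [Function.iterate_succ_apply', Function.iterate_succ_apply']
      exact growthBound_mono hA hL hΨ (hr.trans (hge k r hr)) (ih r s hr hrs)
  have hG : ∀ r, 0 ≤ r → r ≤ growthBound lam A L Ψ r := fun r hr => le_growthBound hA hL hΨ0 hr
  induction N with
  | zero => simpa using hstep
  | succ N ih =>
    intro j x y hx hxy hy hjx hjy
    by_cases hx1 : (j + 1 : ℕ) * Real.pi ≤ θ x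
    · obtain ⟨h1, h2⟩ := ih (j + 1) x y hx hxy hy hx1 (by convert hjy using 3; ring)
      rw [Function.iterate_succ_apply' _ (N + 1) (|u x| + |v x|),
        Function.iterate_succ_apply' _ (N + 1) (|u y| + |v y|)]
      exact ⟨h1.trans (hG _ ((hS y).trans h1)), h2.trans (hG _ ((hS x).trans h2))⟩
    by_cases hy1 : θ y ≤ (j + 1 : ℕ) * Real.pi
    · obtain ⟨h1, h2⟩ := hstep j x y hx hxy hy hjx hy1
      rw [Function.iterate_succ_apply _ (N + 1) (|u x| + |v x|),
        Function.iterate_succ_apply _ (N + 1) (|u y| + |v y|)]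
      exact ⟨h1.trans (hge _ _ ((hS y).trans h1)), h2.trans (hge _ _ ((hS x).trans h2))⟩
    · push Not at hx1 hy1
      obtain ⟨z, hz, hze⟩ := intermediate_value_Icc hxy
        (h.continuousOn_angle.mono (Icc_subset_Icc hx hy)) ⟨hx1.le, hy1.le⟩
      obtain ⟨h1, h2⟩ := hstep j x z hx hz.1 (hz.2.trans hy) hjx hze.le
      obtain ⟨h3, h4⟩ := ih (j + 1) z y (hx.trans hz.1) hz.2 hy hze.ge
        (by convert hjy using 3; ring)
      constructor
      · rw [Function.iterate_succ_apply]
        exact h3.trans (hmono _ _ _ (hS z) h1)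
      · rw [Function.iterate_succ_apply']
        exact h2.trans (growthBound_mono hA hL hΨ (hS z) h4)

/-- For a solution with `n` nodal intervals, the sizes of `|u| + |u'|` at any two points control
each other. -/
lemma abs_add_abs_le_iterate_growthBound (h : IsPrufer L θ σ) (hL : 0 ≤ L)
    (hA : 0 ≤ A) (hΨ : MonotoneOn Ψ (Ici 0)) (hΨ0 : ∀ r, 0 ≤ r → 0 ≤ Ψ r) {u v : ℝ → ℝ}
    (huθ : ∀ t, u t = Real.exp (σ t) * Real.sin (θ t))
    (hu : ∀ t ∈ Icc 0 L, HasDerivAt u (v t) t)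
    (hv : ∀ t ∈ Icc 0 L, HasDerivAt v (-((lam + q t) * u t)) t)
    (hq : ∀ t ∈ Icc 0 L, 0 ≤ q t) (hqΨ : ∀ t ∈ Icc 0 L, q t * |u t| ≤ A * Ψ |u t|)
    {n : ℕ} (h0 : θ 0 = 0) (hn : θ L = n * Real.pi) {x y : ℝ} (hx : x ∈ Icc 0 L)
    (hy : y ∈ Icc 0 L) :
    |u y| + |v y| ≤ (growthBound lam A L Ψ)^[n + 1] (|u x| + |v x|) := by
  have haux := h.abs_add_abs_le_iterate_growthBound_aux hL hA hΨ hΨ0 huθ hu hv hq hqΨ n 0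
  have hlow : ∀ t ∈ Icc 0 L, (0 : ℕ) * Real.pi ≤ θ t := fun t ht => by
    simpa using h.int_mul_pi_le (j := 0) le_rfl ht.1 ht.2 (by simp [h0])
  have hup : ∀ t ∈ Icc 0 L, θ t ≤ (0 + n + 1 : ℕ) * Real.pi := fun t ht => by
    have := h.le_int_mul_pi (j := n) ht.1 ht.2 le_rfl (by simp [hn])
    push_cast at this ⊢
    linarith [Real.pi_pos]
  rcases le_total x y with hxy | hxy
  · exact (haux x y hx.1 hxy hy.2 (hlow x hx) (hup y hy)).1
  · exact (haux y x hy.1 hxy hx.2 (hlow y hy) (hup x hx)).2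

end IsPrufer

/-! ### Regularization of the nonlinearity -/

/-- A smooth substitute for `u ^ 2` that takes values in a compact subset of `(0, ∞)`. -/
noncomputable def regSq (ε u : ℝ) : ℝ := (u ^ 2 + ε) / (1 + ε * (u ^ 2 + ε))

/-- A smooth, bounded and positive substitute for `|u| ^ (p - 1)`. -/
noncomputable def regCoeff (p ε u : ℝ) : ℝ := regSq ε u ^ ((p - 1) / 2)

/-- A bound for `|regCoeff p ε u * u|` in terms of `|u|` that does not depend on `ε`. -/
noncomputable def regModulus (p r : ℝ) : ℝ := (r + r ^ p) * (1 + r ^ 2) ^ (|p - 1| / 2)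

section Regularization

variable {p ε u : ℝ}

lemma regSq_pos (hε : 0 < ε) (u : ℝ) : 0 < regSq ε u := by
  unfold regSq; positivity

lemma regCoeff_pos (hε : 0 < ε) (u : ℝ) : 0 < regCoeff p ε u :=
  Real.rpow_pos_of_pos (regSq_pos hε u) _

lemma contDiff_regCoeff (hε : 0 < ε) : ContDiff ℝ 1 (regCoeff p ε) := by
  refine ContDiff.rpow_const_of_ne ?_ fun u => (regSq_pos hε u).ne'
  refine ContDiff.div (by fun_prop) (by fun_prop) fun u => ?_
  positivity

lemma rpow_le_add_rpow {x lo hi : ℝ} (hlo : 0 < lo) (h1 : lo ≤ x) (h2 : x ≤ hi) (e : ℝ) :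
    x ^ e ≤ lo ^ e + hi ^ e := by
  have hlo' := Real.rpow_nonneg hlo.le e
  have hhi' := Real.rpow_nonneg (hlo.le.trans (h1.trans h2)) e
  rcases le_total 0 e with he | he
  · linarith [Real.rpow_le_rpow (hlo.le.trans h1) h2 he]
  · linarith [Real.rpow_le_rpow_of_nonpos hlo h1 he]

lemma exists_regCoeff_le (hε : 0 < ε) : ∃ M, ∀ u, regCoeff p ε u ≤ M := by
  refine ⟨(ε / (1 + ε * ε)) ^ ((p - 1) / 2) + (1 / ε) ^ ((p - 1) / 2), fun u => ?_⟩
  refine rpow_le_add_rpow (by positivity) ?_ ?_ _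
  · rw [regSq, div_le_div_iff₀ (by positivity) (by positivity)]
    nlinarith [sq_nonneg u]
  · rw [regSq, div_le_div_iff₀ (by positivity) (by positivity)]
    nlinarith [sq_nonneg u]

lemma regModulus_nonneg {r : ℝ} (hr : 0 ≤ r) : 0 ≤ regModulus p r := by
  unfold regModulus; positivity

lemma regModulus_monotoneOn (hp : 0 < p) : MonotoneOn (regModulus p) (Ici 0) := by
  intro r hr s hs hrs
  have hr' : 0 ≤ r := hr
  have hs' : 0 ≤ s := hs
  unfold regModulus
  gcongr

lemma continuous_regModulus (hp : 0 < p) : Continuous (regModulus p) := by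
  refine (continuous_id.add (Real.continuous_rpow_const hp.le)).mul ?_
  refine Continuous.rpow_const (by fun_prop) fun r => Or.inl ?_
  positivity

lemma regModulus_zero (hp : 0 < p) : regModulus p 0 = 0 := by
  simp [regModulus, Real.zero_rpow hp.ne']

lemma regCoeff_mul_abs_le (hp : 0 < p) (hε : 0 < ε) (hε1 : ε ≤ 1) (u : ℝ) :
    regCoeff p ε u * |u| ≤ regModulus p |u| := by
  have hpos := regSq_pos hε u
  have hu := abs_nonneg u
  unfold regModulus
  rcases le_total 1 p with h1 | h1
  · have h2 : regSq ε u ≤ 1 + |u| ^ 2 := by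
      rw [sq_abs, regSq, div_le_iff₀ (by positivity)]
      nlinarith [sq_nonneg u, mul_pos hε hε, mul_nonneg hε.le (sq_nonneg u)]
    rw [abs_of_nonneg (sub_nonneg.2 h1), mul_comm]
    have h3 : regCoeff p ε u ≤ (1 + |u| ^ 2) ^ ((p - 1) / 2) :=
      Real.rpow_le_rpow hpos.le h2 (by linarith)
    have h4 : |u| ≤ |u| + |u| ^ p := by linarith [Real.rpow_nonneg hu p]
    gcongr
    exact (regCoeff_pos hε u).le
  · rcases eq_or_ne u 0 with rfl | hne
    · simp [Real.zero_rpow hp.ne']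
    have hu' : 0 < |u| := abs_pos.2 hne
    rw [abs_of_nonpos (sub_nonpos.2 h1)]
    -- `1 / regSq ε u = 1 / (u² + ε) + ε ≤ 1 / u² + 1`
    have h2 : |u| ^ 2 / (1 + |u| ^ 2) ≤ regSq ε u := by
      rw [sq_abs, regSq, div_le_div_iff₀ (by positivity) (by positivity)]
      nlinarith [sq_nonneg u, mul_pos hε hε, mul_nonneg hε.le (sq_nonneg u),
        mul_nonneg (sub_nonneg.2 hε1) (mul_nonneg (sq_nonneg u) (sq_nonneg u)),
        mul_nonneg (sub_nonneg.2 hε1) (mul_nonneg hε.le (sq_nonneg u))]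
    have h3 : regCoeff p ε u ≤ (|u| ^ 2 / (1 + |u| ^ 2)) ^ ((p - 1) / 2) :=
      Real.rpow_le_rpow_of_nonpos (by positivity) h2 (by linarith)
    have h4 : (|u| ^ 2 / (1 + |u| ^ 2)) ^ ((p - 1) / 2) =
        |u| ^ (p - 1) * (1 + |u| ^ 2) ^ (-(p - 1) / 2) := by
      rw [Real.div_rpow (by positivity) (by positivity), ← Real.rpow_natCast, ← Real.rpow_mul hu,
        div_eq_mul_inv, ← Real.rpow_neg (by positivity)]
      congr 2
      · push_cast; ring
      · ring
    have h5 : |u| ^ (p - 1) * |u| = |u| ^ p := by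
      rw [Real.rpow_sub_one hu'.ne']
      field_simp
    calc regCoeff p ε u * |u| ≤ |u| ^ (p - 1) * (1 + |u| ^ 2) ^ (-(p - 1) / 2) * |u| := by
          rw [← h4]; gcongr
      _ = |u| ^ p * (1 + |u| ^ 2) ^ (-(p - 1) / 2) := by rw [← h5]; ring
      _ ≤ _ := by gcongr; linarith

/-- `regCoeff p ε u * u` converges to `|u| ^ (p - 1) * u` as `ε → 0`, continuously in `u`. -/
lemma tendsto_regCoeff_mul {ι : Type*} {l : Filter ι} {e w : ι → ℝ} {x : ℝ} (hp : 0 < p)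
    (he : Tendsto e l (𝓝 0)) (he0 : ∀ᶠ i in l, 0 < e i) (hw : Tendsto w l (𝓝 x)) :
    Tendsto (fun i => regCoeff p (e i) (w i) * w i) l (𝓝 (|x| ^ (p - 1) * x)) := by
  rcases eq_or_ne x 0 with rfl | hne
  · rw [mul_zero]
    have h1 : Tendsto (fun i => regModulus p |w i|) l (𝓝 0) := by
      have := ((continuous_regModulus hp).tendsto _).comp hw.abs
      simpa [Function.comp_def, regModulus_zero hp] using this
    refine squeeze_zero_norm' ?_ h1
    filter_upwards [he0, he.eventually (ge_mem_nhds (zero_lt_one))] with i hi hi1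
    rw [norm_mul, Real.norm_of_nonneg (regCoeff_pos hi _).le]
    exact regCoeff_mul_abs_le hp hi hi1 _
  · have h1 : Tendsto (fun i => regSq (e i) (w i)) l (𝓝 (x ^ 2)) := by
      have : Tendsto (fun i => regSq (e i) (w i)) l
          (𝓝 ((x ^ 2 + 0) / (1 + 0 * (x ^ 2 + 0)))) := by
        refine Tendsto.div ((hw.pow 2).add he) ?_ (by simp)
        exact tendsto_const_nhds.add (he.mul ((hw.pow 2).add he))
      simpa using this
    have h2 : (x ^ 2) ^ ((p - 1) / 2) = |x| ^ (p - 1) := by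
      rw [← sq_abs, ← Real.rpow_natCast, ← Real.rpow_mul (abs_nonneg x)]
      congr 1
      push_cast; ring
    have h3 := (h1.rpow_const (p := (p - 1) / 2) (Or.inl (pow_ne_zero 2 hne))).mul hw
    rwa [h2] at h3

lemma exists_regSq_le {y : ℝ} (hy : 0 < y) :
    ∃ r > 0, ∃ ε₀ > 0, ∀ ε u, 0 < ε → ε ≤ ε₀ → |u| ≤ r → regSq ε u ≤ y := by
  refine ⟨√(y / 2), by positivity, y / 2, by positivity, fun ε u hε hε0 hu => ?_⟩
  have h1 : u ^ 2 ≤ y / 2 := by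
    rw [← sq_abs, ← Real.sq_sqrt (show 0 ≤ y / 2 by positivity)]
    gcongr
  rw [regSq, div_le_iff₀ (by positivity)]
  have : 0 ≤ y * (ε * (u ^ 2 + ε)) := by positivity
  linarith

lemma exists_le_regSq {y : ℝ} (hy : 0 < y) :
    ∃ U > 0, ∃ ε₀ > 0, ∀ ε u, 0 < ε → ε ≤ ε₀ → U ≤ |u| → y ≤ regSq ε u := by
  refine ⟨√(2 * y), by positivity, 1 / (2 * y), by positivity, fun ε u hε hε0 hu => ?_⟩
  have h1 : 2 * y ≤ u ^ 2 := by
    rw [← sq_abs, ← Real.sq_sqrt (show 0 ≤ 2 * y by positivity)]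
    gcongr
  rw [le_div_iff₀ (by positivity)] at hε0
  rw [regSq, le_div_iff₀ (by positivity)]
  have : (ε * (2 * y)) * (u ^ 2 + ε) ≤ 1 * (u ^ 2 + ε) := by gcongr
  linarith

lemma rpow_inv_half_sub_one {g : ℝ} (hg : 0 < g) (hp : p ≠ 1) :
    (g ^ ((p - 1) / 2)⁻¹) ^ ((p - 1) / 2) = g :=
  Real.rpow_inv_rpow hg.le (div_ne_zero (sub_ne_zero.2 hp) two_ne_zero)

/-- For `p > 1` the coefficient is small for small `u`. -/
lemma exists_regCoeff_le_of_abs_le (hp : 1 < p) {g : ℝ} (hg : 0 < g) :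
    ∃ r > 0, ∃ ε₀ > 0, ∀ ε u, 0 < ε → ε ≤ ε₀ → |u| ≤ r → regCoeff p ε u ≤ g := by
  obtain ⟨r, hr, ε₀, h0, h⟩ := exists_regSq_le (Real.rpow_pos_of_pos hg ((p - 1) / 2)⁻¹)
  refine ⟨r, hr, ε₀, h0, fun ε u h1 h2 h3 => ?_⟩
  rw [← rpow_inv_half_sub_one hg hp.ne']
  exact Real.rpow_le_rpow (regSq_pos h1 u).le (h ε u h1 h2 h3) (by linarith)

/-- For `p > 1` the coefficient is large for large `u`. -/
lemma exists_le_regCoeff_of_le_abs (hp : 1 < p) {g : ℝ} (hg : 0 < g) :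
    ∃ U > 0, ∃ ε₀ > 0, ∀ ε u, 0 < ε → ε ≤ ε₀ → U ≤ |u| → g ≤ regCoeff p ε u := by
  obtain ⟨U, hU, ε₀, h0, h⟩ := exists_le_regSq (Real.rpow_pos_of_pos hg ((p - 1) / 2)⁻¹)
  refine ⟨U, hU, ε₀, h0, fun ε u h1 h2 h3 => ?_⟩
  rw [← rpow_inv_half_sub_one hg hp.ne']
  exact Real.rpow_le_rpow (Real.rpow_nonneg hg.le _) (h ε u h1 h2 h3) (by linarith)

/-- For `p < 1` the coefficient is large for small `u`. -/
lemma exists_le_regCoeff_of_abs_le (hp : p < 1) {g : ℝ} (hg : 0 < g) :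
    ∃ r > 0, ∃ ε₀ > 0, ∀ ε u, 0 < ε → ε ≤ ε₀ → |u| ≤ r → g ≤ regCoeff p ε u := by
  obtain ⟨r, hr, ε₀, h0, h⟩ := exists_regSq_le (Real.rpow_pos_of_pos hg ((p - 1) / 2)⁻¹)
  refine ⟨r, hr, ε₀, h0, fun ε u h1 h2 h3 => ?_⟩
  rw [← rpow_inv_half_sub_one hg hp.ne]
  exact Real.rpow_le_rpow_of_nonpos (regSq_pos h1 u) (h ε u h1 h2 h3) (by linarith)

/-- For `p < 1` the coefficient is small for large `u`. -/
lemma exists_regCoeff_le_of_le_abs (hp : p < 1) {g : ℝ} (hg : 0 < g) :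
    ∃ U > 0, ∃ ε₀ > 0, ∀ ε u, 0 < ε → ε ≤ ε₀ → U ≤ |u| → regCoeff p ε u ≤ g := by
  obtain ⟨U, hU, ε₀, h0, h⟩ := exists_le_regSq (Real.rpow_pos_of_pos hg ((p - 1) / 2)⁻¹)
  refine ⟨U, hU, ε₀, h0, fun ε u h1 h2 h3 => ?_⟩
  rw [← rpow_inv_half_sub_one hg hp.ne]
  exact Real.rpow_le_rpow_of_nonpos (Real.rpow_pos_of_pos hg _) (h ε u h1 h2 h3) (by linarith)

end Regularization

/-! ### The Prüfer system with a bounded smooth nonlinearity -/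

/-- `u = exp σ * sin θ` solves `-u'' = (lam + b t * G u) u` on `[0, L]` with `u 0 = 0`, written as
a system for the angle `θ` and the logarithm `σ` of the radius. -/
structure IsPruferSolution (lam L : ℝ) (b G θ σ : ℝ → ℝ) : Prop where
  hasDerivAt_angle : ∀ t ∈ Icc 0 L, HasDerivAt θ (Real.cos (θ t) ^ 2 +
    (lam + b t * G (Real.exp (σ t) * Real.sin (θ t))) * Real.sin (θ t) ^ 2) t
  hasDerivAt_logRadius : ∀ t ∈ Icc 0 L, HasDerivAt σ (Real.sin (θ t) * Real.cos (θ t) *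
    (1 - (lam + b t * G (Real.exp (σ t) * Real.sin (θ t))))) t
  angle_zero : θ 0 = 0

namespace IsPruferSolution

variable {lam L : ℝ} {b G θ σ : ℝ → ℝ}

lemma hasDerivAt_fst (h : IsPruferSolution lam L b G θ σ) {t : ℝ} (ht : t ∈ Icc 0 L) :
    HasDerivAt (fun s => Real.exp (σ s) * Real.sin (θ s)) (Real.exp (σ t) * Real.cos (θ t)) t := by
  refine ((h.hasDerivAt_logRadius t ht).exp.mul (h.hasDerivAt_angle t ht).sin).congr_deriv ?_
  have := Real.sin_sq_add_cos_sq (θ t)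
  linear_combination Real.exp (σ t) * Real.cos (θ t) * this

lemma hasDerivAt_snd (h : IsPruferSolution lam L b G θ σ) {t : ℝ} (ht : t ∈ Icc 0 L) :
    HasDerivAt (fun s => Real.exp (σ s) * Real.cos (θ s))
      (-((lam + b t * G (Real.exp (σ t) * Real.sin (θ t))) *
        (Real.exp (σ t) * Real.sin (θ t)))) t := by
  refine ((h.hasDerivAt_logRadius t ht).exp.mul (h.hasDerivAt_angle t ht).cos).congr_deriv ?_
  have := Real.sin_sq_add_cos_sq (θ t)
  linear_combination -Real.exp (σ t) * Real.sin (θ t) *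
    (lam + b t * G (Real.exp (σ t) * Real.sin (θ t))) * this

lemma isPrufer (h : IsPruferSolution lam L b G θ σ) : IsPrufer L θ σ where
  continuousOn_angle t ht := (h.hasDerivAt_angle t ht).continuousAt.continuousWithinAt
  continuousOn_logRadius t ht := (h.hasDerivAt_logRadius t ht).continuousAt.continuousWithinAt
  hasDerivWithinAt _ ht := (h.hasDerivAt_fst ht).hasDerivWithinAt

end IsPruferSolution

/-- The solutions of the Prüfer system exist globally, depend continuously on the initial radius,
and their radius stays comparable to the initial one. -/
lemma exists_prufer_flow {lam L A M S : ℝ} {b G : ℝ → ℝ} (hL : 0 ≤ L) (hS : 0 ≤ S)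
    (hb : Continuous b) (hb0 : ∀ t, 0 ≤ b t) (hbA : ∀ t, b t ≤ A)
    (hG : ContDiff ℝ 1 G) (hG0 : ∀ u, 0 ≤ G u) (hGM : ∀ u, G u ≤ M) :
    ∃ θ σ : ℝ → ℝ → ℝ, (∀ s ∈ Icc (-S) S, IsPruferSolution lam L b G (θ s) (σ s) ∧
      ∀ t ∈ Icc 0 L, |σ s t - s| ≤ (1 + |lam| + A * M) * L) ∧
      ContinuousOn (fun s => θ s L) (Icc (-S) S) := by
  have hA : 0 ≤ A := (hb0 0).trans (hbA 0)
  have hM : 0 ≤ M := (hG0 0).trans (hGM 0)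
  set B := 1 + |lam| + A * M with hB
  have hB0 : 0 ≤ B := by positivity
  let Q : ℝ → ℝ × ℝ → ℝ := fun t z => lam + b t * G (Real.exp z.2 * Real.sin z.1)
  let f : ℝ → ℝ × ℝ → ℝ × ℝ := fun t z =>
    (Real.cos z.1 ^ 2 + Q t z * Real.sin z.1 ^ 2, Real.sin z.1 * Real.cos z.1 * (1 - Q t z))
  have hQ : ∀ t z, |Q t z| ≤ |lam| + A * M := by
    intro t z
    refine (abs_add_le _ _).trans (add_le_add le_rfl ?_)
    rw [abs_of_nonneg (mul_nonneg (hb0 t) (hG0 _))]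
    exact mul_le_mul (hbA t) (hGM _) (hG0 _) hA
  have hf1 : ∀ t z, |(f t z).1| ≤ B := by
    intro t z
    have h1 := Real.sin_sq_le_one z.1
    have h2 := Real.cos_sq_le_one z.1
    calc |(f t z).1| ≤ |Real.cos z.1 ^ 2| + |Q t z| * |Real.sin z.1 ^ 2| := by
          rw [← abs_mul]; exact abs_add_le _ _
      _ ≤ 1 + (|lam| + A * M) * 1 := by
          rw [abs_of_nonneg (sq_nonneg (Real.cos z.1)), abs_of_nonneg (sq_nonneg (Real.sin z.1))]
          gcongr
          exact hQ t z
      _ = B := by rw [hB]; ring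
  have hf2 : ∀ t z, |(f t z).2| ≤ B := by
    intro t z
    calc |(f t z).2| = |Real.sin z.1| * |Real.cos z.1| * |1 - Q t z| := by
          rw [← abs_mul, ← abs_mul]
      _ ≤ 1 * 1 * (1 + (|lam| + A * M)) := by
          gcongr
          · exact Real.abs_sin_le_one _
          · exact Real.abs_cos_le_one _
          · refine (abs_sub _ _).trans ?_
            rw [abs_one]
            linarith [hQ t z]
      _ = B := by rw [hB]; ring
  obtain ⟨K1, hK1⟩ : ∃ K, LipschitzOnWith K
      (fun z : ℝ × ℝ => (Real.cos z.1 ^ 2 + lam * Real.sin z.1 ^ 2,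
        Real.sin z.1 * Real.cos z.1 * (1 - lam)))
      (Metric.closedBall (0 : ℝ × ℝ) (S + B * (L + 1))) :=
    ContDiffOn.exists_lipschitzOnWith (n := 1)
      (ContDiff.contDiffOn (by fun_prop)) one_ne_zero (convex_closedBall _ _)
      (isCompact_closedBall _ _)
  obtain ⟨K2, hK2⟩ : ∃ K, LipschitzOnWith K
      (fun z : ℝ × ℝ => (G (Real.exp z.2 * Real.sin z.1) * Real.sin z.1 ^ 2,
        -(Real.sin z.1 * Real.cos z.1 * G (Real.exp z.2 * Real.sin z.1))))
      (Metric.closedBall (0 : ℝ × ℝ) (S + B * (L + 1))) :=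
    ContDiffOn.exists_lipschitzOnWith (n := 1)
      (ContDiff.contDiffOn (by fun_prop)) one_ne_zero (convex_closedBall _ _)
      (isCompact_closedBall _ _)
  have hpl : IsPicardLindelof f (tmin := -1) (tmax := L + 1) ⟨0, by constructor <;> linarith⟩
      (0 : ℝ × ℝ) (.mk (S + B * (L + 1)) (by positivity)) (.mk S hS) (.mk B hB0)
      (K1 + .mk A hA * K2) := by
    refine ⟨fun t _ => ?_, fun z _ => ?_, fun t _ z _ => ?_, ?_⟩
    · refine LipschitzOnWith.of_dist_le_mul fun z hz w hw => ?_
      have h1 := hK1.dist_le_mul z hz w hw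
      have h2 := hK2.dist_le_mul z hz w hw
      rw [dist_eq_norm] at h1 h2 ⊢
      have h3 : f t z - f t w =
          ((Real.cos z.1 ^ 2 + lam * Real.sin z.1 ^ 2,
            Real.sin z.1 * Real.cos z.1 * (1 - lam)) -
          (Real.cos w.1 ^ 2 + lam * Real.sin w.1 ^ 2,
            Real.sin w.1 * Real.cos w.1 * (1 - lam)) : ℝ × ℝ) +
          b t • ((G (Real.exp z.2 * Real.sin z.1) * Real.sin z.1 ^ 2,
            -(Real.sin z.1 * Real.cos z.1 * G (Real.exp z.2 * Real.sin z.1))) -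
          (G (Real.exp w.2 * Real.sin w.1) * Real.sin w.1 ^ 2,
            -(Real.sin w.1 * Real.cos w.1 * G (Real.exp w.2 * Real.sin w.1))) : ℝ × ℝ) := by
        ext
        · simp [f, Q]; ring
        · simp [f, Q]; ring
      rw [h3]
      refine (norm_add_le _ _).trans ?_
      rw [norm_smul, Real.norm_of_nonneg (hb0 t)]
      calc _ ≤ K1 * dist z w + A * (K2 * dist z w) := by
            gcongr
            exact hbA t
        _ = _ := by push_cast; ring
    · refine Continuous.continuousOn ?_
      simp only [f, Q]
      fun_prop
    · rw [Prod.norm_def]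
      exact max_le (hf1 t z) (hf2 t z)
    · have : max (L + 1 - 0) (0 - -1) = L + 1 := by
        rw [max_eq_left] <;> linarith
      simp only [NNReal.coe_mk, this]
      linarith
  obtain ⟨α, hα, K, hK⟩ := hpl.exists_forall_mem_closedBall_eq_hasDerivWithinAt_lipschitzOnWith
  have hmem : ∀ s ∈ Icc (-S) S, ((0, s) : ℝ × ℝ) ∈ Metric.closedBall (0 : ℝ × ℝ) S := by
    intro s hs
    simp [Prod.norm_def, abs_le, hs.1, hs.2]
  have hderiv : ∀ s ∈ Icc (-S) S, ∀ t ∈ Icc 0 L,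
      HasDerivAt (α (0, s)) (f t (α (0, s) t)) t := by
    intro s hs t ht
    refine ((hα _ (hmem s hs)).2 t ⟨by linarith [ht.1], by linarith [ht.2]⟩).hasDerivAt
      (Icc_mem_nhds (by linarith [ht.1]) (by linarith [ht.2]))
  refine ⟨fun s t => (α (0, s) t).1, fun s t => (α (0, s) t).2, fun s hs => ⟨⟨?_, ?_, ?_⟩, ?_⟩, ?_⟩
  · intro t ht
    exact (hderiv s hs t ht).fst
  · intro t ht
    exact (hderiv s hs t ht).snd
  · have := (hα _ (hmem s hs)).1
    simp only at this
    simp [this]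
  · intro t ht
    have h0 := (hα _ (hmem s hs)).1
    simp only at h0
    have hsub : Icc 0 t ⊆ Icc 0 L := Icc_subset_Icc_right ht.2
    have hsnd : ∀ r ∈ Icc 0 t, HasDerivAt (fun r => (α (0, s) r).2) (f r (α (0, s) r)).2 r :=
      fun r hr => (hderiv s hs r (hsub hr)).snd
    have h1 := sub_le_mul_sub_of_hasDerivAt_le (C := B) ht.1 hsnd (fun r _ => (abs_le.1 (hf2 r _)).2)
    have h2 := sub_le_mul_sub_of_hasDerivAt_le (C := B) ht.1
      (fun r hr => (hsnd r hr).neg)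
      (fun r _ => by linarith [(abs_le.1 (hf2 r (α (0, s) r))).1])
    have h3 : B * (t - 0) ≤ B * L := by
      rw [sub_zero]; exact mul_le_mul_of_nonneg_left ht.2 hB0
    simp only [Pi.neg_apply, h0] at h1 h2
    rw [abs_le]
    constructor <;> linarith
  · have h1 : ContinuousOn (fun z => α z L) (Metric.closedBall (0 : ℝ × ℝ) S) :=
      (hK L ⟨by linarith, by linarith⟩).continuousOn
    exact (continuous_fst.comp_continuousOn h1).comp (by fun_prop) hmem

/-! ### The angle of very small and of very large solutions -/

section Angle

variable {lam L A a₀ h p : ℝ} {n : ℕ}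

namespace IsPruferSolution

variable {b G θ σ : ℝ → ℝ}

lemma angle_lt (hs : IsPruferSolution lam L b G θ σ) (hL : 0 ≤ L) {α c : ℝ} (hc : 0 < c)
    (hle : ∀ t ∈ Icc 0 L, Real.cos (θ t) ^ 2 +
      (lam + b t * G (Real.exp (σ t) * Real.sin (θ t))) * Real.sin (θ t) ^ 2 ≤
      α * (Real.cos (θ t) ^ 2 + c ^ 2 * Real.sin (θ t) ^ 2))
    (hn : α * c * L < n * Real.pi) : θ L < n * Real.pi :=
  angle_lt_of_deriv_le hL hc hs.hasDerivAt_angle hs.angle_zero hle hn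

lemma lt_angle (hs : IsPruferSolution lam L b G θ σ) (hh : 0 < h) (hhL : h < L) {α c : ℝ}
    (hc : 0 < c)
    (hle : ∀ t ∈ Icc 0 h, α * (Real.cos (θ t) ^ 2 + c ^ 2 * Real.sin (θ t) ^ 2) ≤
      Real.cos (θ t) ^ 2 +
        (lam + b t * G (Real.exp (σ t) * Real.sin (θ t))) * Real.sin (θ t) ^ 2)
    (hn : n * Real.pi ≤ α * c * h) : n * Real.pi < θ L := by
  have h1 := le_angle_of_le_deriv hh.le hc
    (fun t ht => hs.hasDerivAt_angle t ⟨ht.1, ht.2.trans hhL.le⟩) hs.angle_zero hle hn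
  simpa using hs.isPrufer.int_mul_pi_lt (j := n) hh.le hhL le_rfl (by simpa using h1)

end IsPruferSolution

/-- The weights for which the estimates are uniform: bounded by `A`, and at least `a₀` on the
initial interval `[0, h]`. -/
structure IsAdmissibleWeight (A a₀ h : ℝ) (b : ℝ → ℝ) : Prop where
  nonneg : ∀ t, 0 ≤ b t
  le : ∀ t, b t ≤ A
  le_of_mem : ∀ t ∈ Icc 0 h, a₀ ≤ b t

lemma exists_frequency (hL : 0 < L) (hn : 1 ≤ n) (hlam : lam < (n * Real.pi / L) ^ 2) :
    ∃ c > 0, lam < c ^ 2 ∧ c * L < n * Real.pi := by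
  have hn' : (0 : ℝ) < n := by exact_mod_cast hn
  have h1 : √(max lam 0) < n * Real.pi / L := by
    rw [Real.sqrt_lt' (by positivity)]
    exact max_lt hlam (by positivity)
  obtain ⟨c, hc1, hc2⟩ := exists_between h1
  have hc0 : 0 < c := (Real.sqrt_nonneg _).trans_lt hc1
  refine ⟨c, hc0, ?_, by rwa [lt_div_iff₀ hL] at hc2⟩
  rw [Real.sqrt_lt' hc0] at hc1
  exact (le_max_left _ _).trans_lt hc1

lemma coeff_mul_le {δ β G : ℝ} (hδ : 0 < δ) (hβ0 : 0 ≤ β) (hβ : β ≤ A) (hG : G ≤ δ / (A + 1)) :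
    β * G ≤ δ := by
  have hA : 0 ≤ A := hβ0.trans hβ
  calc β * G ≤ A * (δ / (A + 1)) :=
        (mul_le_mul_of_nonneg_left hG hβ0).trans (mul_le_mul_of_nonneg_right hβ (by positivity))
    _ ≤ δ := by
        rw [← mul_div_assoc, div_le_iff₀ (by positivity)]
        nlinarith

lemma angle_lt_of_small (hp : 1 < p) (hL : 0 < L) (hA : 0 ≤ A) (hn : 1 ≤ n)
    (hlam : lam < (n * Real.pi / L) ^ 2) :
    ∃ r > 0, ∃ ε₀ > 0, ∀ ε, 0 < ε → ε ≤ ε₀ → ∀ b θ σ, IsAdmissibleWeight A a₀ h b →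
      IsPruferSolution lam L b (regCoeff p ε) θ σ →
      (∀ t ∈ Icc 0 L, Real.exp (σ t) ≤ r) → θ L < n * Real.pi := by
  obtain ⟨c, hc, hlc, hcn⟩ := exists_frequency hL hn hlam
  obtain ⟨r, hr, ε₀, h0, H⟩ := exists_regCoeff_le_of_abs_le hp
    (show 0 < (c ^ 2 - lam) / (A + 1) by
      have : 0 < c ^ 2 - lam := by linarith
      positivity)
  refine ⟨r, hr, ε₀, h0, fun ε hε hε0 b θ σ hb hs hσ => ?_⟩
  refine hs.angle_lt hL.le (α := 1) hc (fun t ht => ?_) (by simpa using hcn)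
  have hu : |Real.exp (σ t) * Real.sin (θ t)| ≤ r := by
    rw [abs_mul, abs_of_pos (Real.exp_pos _)]
    calc _ ≤ r * 1 := by
          gcongr
          · exact hσ t ht
          · exact Real.abs_sin_le_one _
      _ = r := mul_one r
  have h1 := coeff_mul_le (by linarith) (hb.nonneg t) (hb.le t) (H ε _ hε hε0 hu)
  have h2 := mul_le_mul_of_nonneg_right h1 (sq_nonneg (Real.sin (θ t)))
  linarith

lemma lt_angle_of_large (hp : 1 < p) (hh : 0 < h) (hhL : h < L) (ha₀ : 0 < a₀) (hn : 1 ≤ n) :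
    ∃ D > 0, ∃ ε₀ > 0, ∀ ε, 0 < ε → ε ≤ ε₀ → ∀ b θ σ, IsAdmissibleWeight A a₀ h b →
      IsPruferSolution lam L b (regCoeff p ε) θ σ →
      (∀ t ∈ Icc 0 L, D ≤ Real.exp (σ t)) → n * Real.pi < θ L := by
  have hn' : (0 : ℝ) < n := by exact_mod_cast hn
  set c := 2 * n * Real.pi / h with hc_def
  have hc : 0 < c := by positivity
  obtain ⟨U, hU, ε₀, h0, H⟩ := exists_le_regCoeff_of_le_abs hp
    (show 0 < (c ^ 2 / 2 + |lam|) / a₀ by positivity)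
  refine ⟨U * √(1 + c ^ 2 + 2 * |lam|), by positivity, ε₀, h0,
    fun ε hε hε0 b θ σ hb hs hσ => ?_⟩
  refine hs.lt_angle hh hhL (α := 1 / 2) hc (fun t ht => ?_) ?_
  swap
  · rw [hc_def]
    field_simp
    exact le_rfl
  have htL : t ∈ Icc 0 L := ⟨ht.1, ht.2.trans hhL.le⟩
  have hsc := Real.sin_sq_add_cos_sq (θ t)
  have hs0 := sq_nonneg (Real.sin (θ t))
  have hG0 := regCoeff_pos (p := p) hε (Real.exp (σ t) * Real.sin (θ t))
  have hl := neg_abs_le lam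
  rcases le_or_gt U |Real.exp (σ t) * Real.sin (θ t)| with hu | hu
  · have h1 : c ^ 2 / 2 + |lam| ≤ b t * regCoeff p ε (Real.exp (σ t) * Real.sin (θ t)) := by
      have h2 := mul_le_mul (hb.le_of_mem t ht) (H ε _ hε hε0 hu) (by positivity) (hb.nonneg t)
      rwa [mul_div_cancel₀ _ ha₀.ne'] at h2
    nlinarith [sq_nonneg (Real.cos (θ t))]
  · -- Near a zero of `u` the angle is near a multiple of `π`, where it turns at speed about `1`.
    have h1 : (1 + c ^ 2 + 2 * |lam|) * Real.sin (θ t) ^ 2 ≤ 1 := by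
      have h3 : (U * √(1 + c ^ 2 + 2 * |lam|)) ^ 2 * Real.sin (θ t) ^ 2 ≤ U ^ 2 :=
        calc _ ≤ Real.exp (σ t) ^ 2 * Real.sin (θ t) ^ 2 := by
              gcongr
              exact hσ t htL
          _ = |Real.exp (σ t) * Real.sin (θ t)| ^ 2 := by rw [sq_abs]; ring
          _ ≤ U ^ 2 := by gcongr
      rw [mul_pow, Real.sq_sqrt (by positivity), mul_assoc] at h3
      exact le_of_mul_le_mul_left (by simpa using h3) (by positivity : 0 < U ^ 2)
    have h2 : 0 ≤ b t * regCoeff p ε (Real.exp (σ t) * Real.sin (θ t)) * Real.sin (θ t) ^ 2 :=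
      mul_nonneg (mul_nonneg (hb.nonneg t) hG0.le) hs0
    nlinarith

lemma lt_angle_of_small (hp : p < 1) (hh : 0 < h) (hhL : h < L) (ha₀ : 0 < a₀) (hn : 1 ≤ n) :
    ∃ r > 0, ∃ ε₀ > 0, ∀ ε, 0 < ε → ε ≤ ε₀ → ∀ b θ σ, IsAdmissibleWeight A a₀ h b →
      IsPruferSolution lam L b (regCoeff p ε) θ σ →
      (∀ t ∈ Icc 0 L, Real.exp (σ t) ≤ r) → n * Real.pi < θ L := by
  have hn' : (0 : ℝ) < n := by exact_mod_cast hn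
  set c := n * Real.pi / h with hc_def
  have hc : 0 < c := by positivity
  obtain ⟨r, hr, ε₀, h0, H⟩ := exists_le_regCoeff_of_abs_le hp
    (show 0 < (c ^ 2 + |lam|) / a₀ by positivity)
  refine ⟨r, hr, ε₀, h0, fun ε hε hε0 b θ σ hb hs hσ => ?_⟩
  refine hs.lt_angle hh hhL (α := 1) hc (fun t ht => ?_) ?_
  swap
  · rw [hc_def]
    field_simp
    exact le_rfl
  have htL : t ∈ Icc 0 L := ⟨ht.1, ht.2.trans hhL.le⟩
  have hs0 := sq_nonneg (Real.sin (θ t))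
  have hu : |Real.exp (σ t) * Real.sin (θ t)| ≤ r := by
    rw [abs_mul, abs_of_pos (Real.exp_pos _)]
    calc _ ≤ r * 1 := by
          gcongr
          · exact hσ t htL
          · exact Real.abs_sin_le_one _
      _ = r := mul_one r
  have h1 : c ^ 2 + |lam| ≤ b t * regCoeff p ε (Real.exp (σ t) * Real.sin (θ t)) := by
    have h2 := mul_le_mul (hb.le_of_mem t ht) (H ε _ hε hε0 hu) (by positivity) (hb.nonneg t)
    rwa [mul_div_cancel₀ _ ha₀.ne'] at h2
  nlinarith [neg_abs_le lam]

lemma angle_lt_of_large (hp0 : 0 < p) (hp : p < 1) (hL : 0 < L) (hA : 0 ≤ A) (hn : 1 ≤ n)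
    (hlam : lam < (n * Real.pi / L) ^ 2) :
    ∃ D > 0, ∃ ε₀ > 0, ∀ ε, 0 < ε → ε ≤ ε₀ → ∀ b θ σ, IsAdmissibleWeight A a₀ h b →
      IsPruferSolution lam L b (regCoeff p ε) θ σ →
      (∀ t ∈ Icc 0 L, D ≤ Real.exp (σ t)) → θ L < n * Real.pi := by
  obtain ⟨c, hc, hlc, hcn⟩ := exists_frequency hL hn hlam
  obtain ⟨α, hα1, hα2⟩ := exists_between ((one_lt_div (by positivity)).2 hcn)
  obtain ⟨U, hU, ε₀, h0, H⟩ := exists_regCoeff_le_of_le_abs hp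
    (show 0 < (c ^ 2 - lam) / (A + 1) by
      have : 0 < c ^ 2 - lam := by linarith
      positivity)
  have hκ : 0 < (α - 1) * min 1 (c ^ 2) := mul_pos (by linarith) (by positivity)
  have hX : 0 ≤ A * (regModulus p U * U) / ((α - 1) * min 1 (c ^ 2)) := by
    have := regModulus_nonneg (p := p) hU.le
    positivity
  refine ⟨√(A * (regModulus p U * U) / ((α - 1) * min 1 (c ^ 2)) + 1), by positivity,
    min ε₀ 1, by positivity, fun ε hε hε0 b θ σ hb hs hσ => ?_⟩
  refine hs.angle_lt hL.le (α := α) hc (fun t ht => ?_) ?_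
  swap
  · rwa [lt_div_iff₀ (by positivity), ← mul_assoc] at hα2
  have hsc := Real.sin_sq_add_cos_sq (θ t)
  have hs0 := sq_nonneg (Real.sin (θ t))
  have hG0 := regCoeff_pos (p := p) hε (Real.exp (σ t) * Real.sin (θ t))
  have hmin : min 1 (c ^ 2) ≤ Real.cos (θ t) ^ 2 + c ^ 2 * Real.sin (θ t) ^ 2 := by
    rcases le_total 1 (c ^ 2) with h1 | h1
    · rw [min_eq_left h1]; nlinarith
    · rw [min_eq_right h1]; nlinarith
  have hmin' : (α - 1) * min 1 (c ^ 2) ≤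
      (α - 1) * (Real.cos (θ t) ^ 2 + c ^ 2 * Real.sin (θ t) ^ 2) :=
    mul_le_mul_of_nonneg_left hmin (by linarith)
  rcases le_or_gt U |Real.exp (σ t) * Real.sin (θ t)| with hu | hu
  · have h1 := coeff_mul_le (by linarith) (hb.nonneg t) (hb.le t)
      (H ε _ hε (hε0.trans (min_le_left _ _)) hu)
    have h2 := mul_le_mul_of_nonneg_right h1 hs0
    linarith
  · -- Near a zero of `u` the nonlinear term is at most a multiple of `(U / radius) ^ 2`.
    have h1 : b t * regCoeff p ε (Real.exp (σ t) * Real.sin (θ t)) * Real.sin (θ t) ^ 2 ≤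
        (α - 1) * min 1 (c ^ 2) := by
      have h2 : (A * (regModulus p U * U) / ((α - 1) * min 1 (c ^ 2)) + 1) ≤
          Real.exp (σ t) ^ 2 := by
        have h3 := hσ t ht
        rwa [Real.sqrt_le_left (Real.exp_pos _).le] at h3
      have h4 : A * (regModulus p U * U) ≤ (α - 1) * min 1 (c ^ 2) * Real.exp (σ t) ^ 2 := by
        rw [mul_comm _ (Real.exp (σ t) ^ 2), ← div_le_iff₀ hκ]
        linarith
      have h5 : b t * regCoeff p ε (Real.exp (σ t) * Real.sin (θ t)) * Real.sin (θ t) ^ 2 *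
          Real.exp (σ t) ^ 2 ≤ A * (regModulus p U * U) :=
        calc _ = b t * (regCoeff p ε (Real.exp (σ t) * Real.sin (θ t)) *
                |Real.exp (σ t) * Real.sin (θ t)| * |Real.exp (σ t) * Real.sin (θ t)|) := by
              rw [mul_assoc (regCoeff _ _ _), ← sq, sq_abs]; ring
          _ ≤ A * (regModulus p U * U) := by
              have h6 := regCoeff_mul_abs_le hp0 hε (hε0.trans (min_le_right _ _))
                (Real.exp (σ t) * Real.sin (θ t))
              have h7 := h6.trans (regModulus_monotoneOn hp0 (mem_Ici.2 (abs_nonneg _))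
                (mem_Ici.2 hU.le) hu.le)
              have h8 := regModulus_nonneg (p := p) hU.le
              gcongr
              exact hb.le t
      exact le_of_mul_le_mul_right (h5.trans h4) (by positivity)
    nlinarith

/-- The angle at `L` lies on one side of `n * π` for small solutions and on the other one for large
solutions; the sign `e` tells which, and depends on whether `p > 1` or `p < 1`. -/
lemma exists_angle_dichotomy (hp : 0 < p) (hp1 : p ≠ 1) (hh : 0 < h) (hhL : h < L)
    (hA : 0 ≤ A) (ha₀ : 0 < a₀) (hn : 1 ≤ n) (hlam : lam < (n * Real.pi / L) ^ 2) :
    ∃ e : ℝ, e ≠ 0 ∧ ∃ r > 0, ∃ D > 0, ∃ ε₀ > 0, ∀ ε, 0 < ε → ε ≤ ε₀ → ∀ b θ σ,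
      IsAdmissibleWeight A a₀ h b → IsPruferSolution lam L b (regCoeff p ε) θ σ →
      ((∀ t ∈ Icc 0 L, Real.exp (σ t) ≤ r) → 0 < e * (n * Real.pi - θ L)) ∧
      ((∀ t ∈ Icc 0 L, D ≤ Real.exp (σ t)) → 0 < e * (θ L - n * Real.pi)) := by
  have hL := hh.trans hhL
  rcases lt_or_gt_of_ne hp1 with hlt | hgt
  · obtain ⟨r, hr, ε₁, h1, H1⟩ := lt_angle_of_small (A := A) (lam := lam) hlt hh hhL ha₀ hn
    obtain ⟨D, hD, ε₂, h2, H2⟩ := angle_lt_of_large (a₀ := a₀) (h := h) hp hlt hL hA hn hlam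
    refine ⟨-1, by norm_num, r, hr, D, hD, min ε₁ ε₂, lt_min h1 h2, fun ε hε hε0 b θ σ hb hs =>
      ⟨fun hσ => ?_, fun hσ => ?_⟩⟩
    · linarith [H1 ε hε (hε0.trans (min_le_left _ _)) b θ σ hb hs hσ]
    · linarith [H2 ε hε (hε0.trans (min_le_right _ _)) b θ σ hb hs hσ]
  · obtain ⟨r, hr, ε₁, h1, H1⟩ := angle_lt_of_small (a₀ := a₀) (h := h) hgt hL hA hn hlam
    obtain ⟨D, hD, ε₂, h2, H2⟩ := lt_angle_of_large (A := A) (lam := lam) hgt hh hhL ha₀ hn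
    refine ⟨1, one_ne_zero, r, hr, D, hD, min ε₁ ε₂, lt_min h1 h2, fun ε hε hε0 b θ σ hb hs =>
      ⟨fun hσ => ?_, fun hσ => ?_⟩⟩
    · linarith [H1 ε hε (hε0.trans (min_le_left _ _)) b θ σ hb hs hσ]
    · linarith [H2 ε hε (hε0.trans (min_le_right _ _)) b θ σ hb hs hσ]

/-- The regularized problems have solutions whose angle at `L` is `n * π`, with bounds for the
radius that do not depend on the regularization. -/
lemma exists_pruferSolution_bounds (hp : 0 < p) (hp1 : p ≠ 1) (hh : 0 < h) (hhL : h < L)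
    (hA : 0 ≤ A) (ha₀ : 0 < a₀) (hn : 1 ≤ n) (hlam : lam < (n * Real.pi / L) ^ 2) :
    ∃ m M : ℝ, ∃ ε₀ > 0, ∀ ε, 0 < ε → ε ≤ ε₀ → ∀ b, Continuous b →
      IsAdmissibleWeight A a₀ h b → ∃ θ σ, IsPruferSolution lam L b (regCoeff p ε) θ σ ∧
        θ L = n * Real.pi ∧ ∀ t ∈ Icc 0 L, σ t ∈ Icc m M := by
  have hL := hh.trans hhL
  obtain ⟨e, he, r, hr, D, hD, ε₀, h0, H⟩ := exists_angle_dichotomy hp hp1 hh hhL hA ha₀ hn hlam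
  set ω := (growthBound lam A L (regModulus p))^[n + 1] with hω
  have hωc : Continuous ω := (continuous_growthBound (continuous_regModulus hp)).iterate _
  have hω0 : ω 0 = 0 := Function.iterate_fixed (growthBound_zero (regModulus_zero hp)) _
  obtain ⟨c, hc, hcω⟩ : ∃ c > 0, ∀ s, 0 ≤ s → s < c → ω s < r := by
    have h1 := Metric.continuousAt_iff.1 (hωc.continuousAt (x := 0)) r hr
    obtain ⟨c, hc, h2⟩ := h1
    refine ⟨c, hc, fun s hs hsc => ?_⟩
    have h3 := h2 (x := s) (by rwa [Real.dist_eq, sub_zero, abs_of_nonneg hs])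
    rw [hω0, Real.dist_eq, sub_zero] at h3
    exact (le_abs_self _).trans_lt h3
  obtain ⟨C, hC, hCω⟩ : ∃ C > 0, ∀ s ∈ Icc 0 (2 * D), ω s ≤ C := by
    obtain ⟨C, hC⟩ :=
      isCompact_Icc.exists_bound_of_continuousOn (hωc.continuousOn (s := Icc 0 (2 * D)))
    exact ⟨max C 1, by positivity, fun s hs =>
      (le_abs_self _).trans ((hC s hs).trans (le_max_left _ _))⟩
  refine ⟨Real.log (c / 2), Real.log C, min ε₀ 1, by positivity,
    fun ε hε hε0 b hbc hb => ?_⟩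
  have hε1 : ε ≤ 1 := hε0.trans (min_le_right _ _)
  have H := H ε hε (hε0.trans (min_le_left _ _)) b
  obtain ⟨M, hM⟩ := exists_regCoeff_le (p := p) hε
  have hM0 : 0 ≤ M := (regCoeff_pos hε 0).le.trans (hM 0)
  set B := (1 + |lam| + A * M) * L with hB
  have hB0 : 0 ≤ B := by positivity
  set S := |Real.log r| + |Real.log D| + B with hS
  have hS0 : 0 ≤ S := by positivity
  obtain ⟨θ, σ, hθσ, hcont⟩ := exists_prufer_flow (lam := lam) (S := S) hL.le hS0 hbc hb.nonneg
    hb.le (contDiff_regCoeff (p := p) hε) (fun u => (regCoeff_pos hε u).le) hM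
  obtain ⟨s, hs, hse⟩ : ∃ s ∈ Icc (-S) S, e * (θ s L - n * Real.pi) = 0 := by
    have hlow : e * (θ (-S) L - n * Real.pi) ≤ 0 := by
      obtain ⟨h1, h2⟩ := hθσ (-S) ⟨le_rfl, by linarith⟩
      have h3 := (H _ _ hb h1).1 fun t ht => by
        rw [← Real.le_log_iff_exp_le hr]
        linarith [(abs_le.1 (h2 t ht)).2, neg_abs_le (Real.log r), abs_nonneg (Real.log D)]
      linarith
    have hhigh : 0 ≤ e * (θ S L - n * Real.pi) := by
      obtain ⟨h1, h2⟩ := hθσ S ⟨by linarith, le_rfl⟩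
      refine ((H _ _ hb h1).2 fun t ht => ?_).le
      rw [← Real.log_le_iff_le_exp hD]
      linarith [(abs_le.1 (h2 t ht)).1, le_abs_self (Real.log D), abs_nonneg (Real.log r)]
    exact intermediate_value_Icc (f := fun s => e * (θ s L - n * Real.pi))
      (by linarith : -S ≤ S) (by fun_prop) ⟨hlow, hhigh⟩
  obtain ⟨hsol, -⟩ := hθσ s hs
  obtain ⟨Hs, Hl⟩ := H _ _ hb hsol
  have hθL : θ s L = n * Real.pi := by
    linarith [(mul_eq_zero.1 hse).resolve_left he]
  refine ⟨θ s, σ s, hsol, hθL, ?_⟩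
  obtain ⟨x, hx, hxr⟩ : ∃ x ∈ Icc 0 L, r < Real.exp (σ s x) := by
    by_contra! hcon
    exact absurd (Hs hcon) (by simp [hθL])
  obtain ⟨y, hy, hyD⟩ : ∃ y ∈ Icc 0 L, Real.exp (σ s y) < D := by
    by_contra! hcon
    exact absurd (Hl hcon) (by simp [hθL])
  set u := fun t => Real.exp (σ s t) * Real.sin (θ s t) with hu
  set v := fun t => Real.exp (σ s t) * Real.cos (θ s t) with hv
  have hlow : ∀ t, Real.exp (σ s t) ≤ |u t| + |v t| := by
    intro t
    have h1 := Real.sin_sq_add_cos_sq (θ s t)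
    have h2 : 1 ≤ |Real.sin (θ s t)| + |Real.cos (θ s t)| := by
      have h3 := Real.abs_sin_le_one (θ s t)
      have h4 := Real.abs_cos_le_one (θ s t)
      rw [← sq_abs (Real.sin _), ← sq_abs (Real.cos _)] at h1
      nlinarith [abs_nonneg (Real.sin (θ s t)), abs_nonneg (Real.cos (θ s t))]
    simp only [hu, hv, abs_mul, abs_of_pos (Real.exp_pos (σ s t))]
    nlinarith [Real.exp_pos (σ s t)]
  have hup : ∀ t, |u t| + |v t| ≤ 2 * Real.exp (σ s t) := by
    intro t
    have h3 := Real.abs_sin_le_one (θ s t)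
    have h4 := Real.abs_cos_le_one (θ s t)
    simp only [hu, hv, abs_mul, abs_of_pos (Real.exp_pos (σ s t))]
    nlinarith [Real.exp_pos (σ s t)]
  have hprop : ∀ x ∈ Icc 0 L, ∀ y ∈ Icc 0 L, |u y| + |v y| ≤ ω (|u x| + |v x|) :=
    fun x hx y hy => hsol.isPrufer.abs_add_abs_le_iterate_growthBound (lam := lam) (v := v)
      (q := fun t => b t * regCoeff p ε (u t)) hL.le hA (regModulus_monotoneOn hp)
      (fun r hr => regModulus_nonneg hr) (fun t => rfl) (fun t ht => hsol.hasDerivAt_fst ht)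
      (fun t ht => hsol.hasDerivAt_snd ht)
      (fun t _ => mul_nonneg (hb.nonneg t) (regCoeff_pos hε _).le)
      (fun t _ => by
        rw [mul_assoc]
        exact mul_le_mul (hb.le t) (regCoeff_mul_abs_le hp hε hε1 _)
          (mul_nonneg (regCoeff_pos hε _).le (abs_nonneg _)) hA)
      hsol.angle_zero hθL hx hy
  intro t ht
  constructor
  · rw [Real.log_le_iff_le_exp (by positivity)]
    by_contra! hcon
    have h1 := hcω (|u t| + |v t|) (by positivity) (by linarith [hup t])
    linarith [hprop t ht x hx, hlow x]
  · rw [Real.le_log_iff_exp_le hC]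
    exact (hlow t).trans ((hprop y hy t ht).trans
      (hCω _ ⟨by positivity, by linarith [hup y]⟩))

end Angle

open MeasureTheory

/-! ### Passage to the limit -/

namespace IsAdmissibleWeight

variable {A a₀ h : ℝ} {a : ℝ → ℝ}

lemma intervalIntegrable (ha : IsAdmissibleWeight A a₀ h a) (hm : AEStronglyMeasurable a volume)
    (x y : ℝ) : IntervalIntegrable a volume x y := by
  refine (intervalIntegrable_const (c := A)).mono_fun hm.restrict (Eventually.of_forall fun t => ?_)
  simp only [Real.norm_eq_abs, abs_of_nonneg (ha.nonneg t)]
  exact (ha.le t).trans (le_abs_self A)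

end IsAdmissibleWeight

/-- A bounded measurable weight is the almost everywhere limit of its forward averages, which are
continuous. -/
lemma exists_continuous_approx {A a₀ h : ℝ} {a : ℝ → ℝ} (hm : AEStronglyMeasurable a volume)
    (ha : IsAdmissibleWeight A a₀ h a) (hh : 0 < h) :
    ∃ b : ℕ → ℝ → ℝ, (∀ k, Continuous (b k)) ∧
      (∀ᶠ k in atTop, IsAdmissibleWeight A a₀ (h / 2) (b k)) ∧
      ∀ᵐ x, Tendsto (fun k => b k x) atTop (𝓝 (a x)) := by
  have hint := ha.intervalIntegrable hm
  have hloc : LocallyIntegrable a volume := by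
    rw [locallyIntegrable_iff]
    intro K hK
    refine Measure.integrableOn_of_bounded (M := A) hK.measure_lt_top.ne hm
      (Eventually.of_forall fun t => ?_)
    rw [Real.norm_of_nonneg (ha.nonneg t)]
    exact ha.le t
  set F : ℝ → ℝ := fun x => ∫ t in (0 : ℝ)..x, a t with hF
  have hFc : Continuous F := intervalIntegral.continuous_primitive hint 0
  set δ : ℕ → ℝ := fun k => 1 / ((k : ℝ) + 1) with hδ
  have hδ0 : ∀ k, 0 < δ k := fun k => by positivity
  have hδt : Tendsto δ atTop (𝓝 0) := tendsto_one_div_add_atTop_nhds_zero_nat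
  have hsub : ∀ k x, F (x + δ k) - F x = ∫ t in x..(x + δ k), a t := fun k x =>
    intervalIntegral.integral_interval_sub_left (hint _ _) (hint _ _)
  have hlen : ∀ k x c, ∫ _ in x..(x + δ k), c = δ k * c := fun k x c => by simp
  refine ⟨fun k x => (δ k)⁻¹ • (F (x + δ k) - F x), fun k => by fun_prop, ?_, ?_⟩
  · filter_upwards [hδt.eventually (ge_mem_nhds (half_pos hh))] with k hk
    have hle : ∀ x, x ≤ x + δ k := fun x => by linarith [hδ0 k]
    refine ⟨fun x => ?_, fun x => ?_, fun x hx => ?_⟩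
    · rw [hsub, smul_eq_mul]
      exact mul_nonneg (inv_nonneg.2 (hδ0 k).le)
        (intervalIntegral.integral_nonneg (hle x) fun t _ => ha.nonneg t)
    · rw [hsub, smul_eq_mul, inv_mul_le_iff₀ (hδ0 k), ← hlen k x A]
      exact intervalIntegral.integral_mono_on (hle x) (hint _ _) intervalIntegrable_const
        fun t _ => ha.le t
    · rw [hsub, smul_eq_mul, le_inv_mul_iff₀ (hδ0 k), ← hlen k x a₀]
      exact intervalIntegral.integral_mono_on (hle x) intervalIntegrable_const (hint _ _)
        fun t ht => ha.le_of_mem t ⟨hx.1.trans ht.1, by linarith [hx.2, ht.2]⟩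
  · filter_upwards [LocallyIntegrable.ae_hasDerivAt_integral hloc] with x hx
    exact (hx 0).tendsto_slope_zero_right.comp
      (tendsto_nhdsWithin_iff.2 ⟨hδt, Eventually.of_forall hδ0⟩)

/-- A form of the Arzelà–Ascoli theorem. -/
lemma exists_subseq_tendsto_of_lipschitzOnWith {L : ℝ} (hL : 0 ≤ L) {E : Type*}
    [PseudoMetricSpace E] [T2Space E] {s : Set E} (hs : IsCompact s) {K : NNReal} {f : ℕ → ℝ → E}
    (hf : ∀ k, LipschitzOnWith K (f k) (Icc 0 L)) (hfs : ∀ k, ∀ t ∈ Icc 0 L, f k t ∈ s) :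
    ∃ φ : ℕ → ℕ, StrictMono φ ∧ ∃ g : ℝ → E, Continuous g ∧
      ∀ t ∈ Icc 0 L, Tendsto (fun k => f (φ k) t) atTop (𝓝 (g t)) := by
  have hlip : ∀ k, LipschitzWith K (fun t : Icc (0 : ℝ) L => f k t) := fun k =>
    (hf k).to_restrict
  let F : ℕ → BoundedContinuousFunction (Icc (0 : ℝ) L) E := fun k =>
    BoundedContinuousFunction.mkOfCompact ⟨fun t => f k t, (hlip k).continuous⟩
  have hcomp : IsCompact (closure (range F)) := by
    refine BoundedContinuousFunction.arzela_ascoli s hs _ ?_ ?_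
    · rintro _ x ⟨k, rfl⟩
      exact hfs k x x.2
    · refine LipschitzWith.uniformEquicontinuous _ K ?_ |>.equicontinuous
      rintro ⟨_, k, rfl⟩
      exact hlip k
  obtain ⟨g, -, φ, hφ, hlim⟩ := hcomp.tendsto_subseq (x := F) fun k => subset_closure ⟨k, rfl⟩
  refine ⟨φ, hφ, fun t => g (projIcc 0 L hL t), g.continuous.comp continuous_projIcc,
    fun t ht => ?_⟩
  have h1 := ((continuous_eval_const (projIcc 0 L hL t)).tendsto g).comp hlim
  simpa [F, Function.comp_def, projIcc_of_mem hL ht] using h1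

/-- The Prüfer angle and radius of a solution of the integrated problem, for a bounded measurable
weight. -/
theorem exists_prufer_integral_solution {lam L A a₀ h p : ℝ} {n : ℕ} {a : ℝ → ℝ} (hp : 0 < p)
    (hp1 : p ≠ 1) (hh : 0 < h) (hhL : h ≤ L) (ha₀ : 0 < a₀) (hn : 1 ≤ n)
    (hlam : lam < (n * Real.pi / L) ^ 2) (hm : AEStronglyMeasurable a volume)
    (ha : IsAdmissibleWeight A a₀ h a) :
    ∃ θ σ : ℝ → ℝ, Continuous θ ∧ Continuous σ ∧ θ 0 = 0 ∧ θ L = n * Real.pi ∧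
      ∀ x ∈ Icc 0 L,
        Real.exp (σ x) * Real.sin (θ x) = ∫ t in (0 : ℝ)..x, Real.exp (σ t) * Real.cos (θ t) ∧
        Real.exp (σ x) * Real.cos (θ x) = Real.exp (σ 0) * Real.cos (θ 0) -
          ∫ t in (0 : ℝ)..x, (lam * (Real.exp (σ t) * Real.sin (θ t)) +
            a t * (|Real.exp (σ t) * Real.sin (θ t)| ^ (p - 1) *
              (Real.exp (σ t) * Real.sin (θ t)))) := by
  have hL : 0 < L := hh.trans_le hhL
  have hA : 0 ≤ A := (ha.nonneg 0).trans (ha.le 0)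
  obtain ⟨b, hbc, hba, hblim⟩ := exists_continuous_approx hm ha hh
  obtain ⟨m, M, ε₀, hε₀, H⟩ := exists_pruferSolution_bounds hp hp1 (half_pos hh)
    (by linarith : h / 2 < L) hA ha₀ hn hlam
  have hδ : Tendsto (fun k : ℕ => 1 / ((k : ℝ) + 1)) atTop (𝓝 0) :=
    tendsto_one_div_add_atTop_nhds_zero_nat
  obtain ⟨k₀, hk₀⟩ := eventually_atTop.1
    (hba.and (hδ.eventually (ge_mem_nhds (lt_min hε₀ one_pos))))
  set e : ℕ → ℝ := fun k => 1 / (((k + k₀ : ℕ) : ℝ) + 1) with he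
  have he0 : ∀ k, 0 < e k := fun k => by positivity
  have helim : Tendsto e atTop (𝓝 0) := hδ.comp (tendsto_add_atTop_nat k₀)
  have hadm : ∀ k, IsAdmissibleWeight A a₀ (h / 2) (b (k + k₀)) := fun k =>
    (hk₀ (k + k₀) (Nat.le_add_left _ _)).1
  have hek : ∀ k, e k ≤ min ε₀ 1 := fun k => (hk₀ (k + k₀) (Nat.le_add_left _ _)).2
  choose θ σ hsol hθL hσ using fun k => H (e k) (he0 k) ((hek k).trans (min_le_left _ _))
    (b (k + k₀)) (hbc _) (hadm k)
  have hmod0 := regModulus_nonneg (p := p) (Real.exp_pos M).le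
  set K : ℝ := 1 + |lam| + A * regModulus p (Real.exp M) * Real.exp (-m) with hK
  have hK0 : 0 ≤ K := by positivity
  have hu_le : ∀ k, ∀ t ∈ Icc 0 L, |Real.exp (σ k t) * Real.sin (θ k t)| ≤ Real.exp M := by
    intro k t ht
    rw [abs_mul, abs_of_pos (Real.exp_pos _)]
    calc _ ≤ Real.exp M * 1 := by
          gcongr
          · exact (hσ k t ht).2
          · exact Real.abs_sin_le_one _
      _ = _ := mul_one _
  have hΦ : ∀ k, ∀ t ∈ Icc 0 L, b (k + k₀) t *
      (regCoeff p (e k) (Real.exp (σ k t) * Real.sin (θ k t)) *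
        |Real.exp (σ k t) * Real.sin (θ k t)|) ≤ A * regModulus p (Real.exp M) := by
    intro k t ht
    refine mul_le_mul ((hadm k).le t) ?_ (mul_nonneg (regCoeff_pos (he0 k) _).le (abs_nonneg _)) hA
    exact (regCoeff_mul_abs_le hp (he0 k) ((hek k).trans (min_le_right _ _)) _).trans
      (regModulus_monotoneOn hp (mem_Ici.2 (abs_nonneg _)) (mem_Ici.2 (Real.exp_pos M).le)
        (hu_le k t ht))
  have hbG : ∀ k, ∀ t ∈ Icc 0 L, b (k + k₀) t *
      regCoeff p (e k) (Real.exp (σ k t) * Real.sin (θ k t)) * |Real.sin (θ k t)| ≤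
        A * regModulus p (Real.exp M) * Real.exp (-m) := by
    intro k t ht
    have h1 := hΦ k t ht
    rw [abs_mul, abs_of_pos (Real.exp_pos _)] at h1
    have h2 : Real.exp (-σ k t) ≤ Real.exp (-m) := by
      gcongr
      exact (hσ k t ht).1
    calc _ = b (k + k₀) t * (regCoeff p (e k) (Real.exp (σ k t) * Real.sin (θ k t)) *
            (Real.exp (σ k t) * |Real.sin (θ k t)|)) * Real.exp (-σ k t) := by
          have : Real.exp (σ k t) * Real.exp (-σ k t) = 1 := by rw [← Real.exp_add]; simp
          linear_combination -(b (k + k₀) t *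
            regCoeff p (e k) (Real.exp (σ k t) * Real.sin (θ k t)) * |Real.sin (θ k t)|) * this
      _ ≤ _ := mul_le_mul h1 h2 (Real.exp_pos _).le (by positivity)
  have hlipθ : ∀ k, LipschitzOnWith (.mk K hK0) (θ k) (Icc 0 L) := by
    intro k
    refine (convex_Icc 0 L).lipschitzOnWith_of_nnnorm_hasDerivWithin_le
      (fun t ht => ((hsol k).hasDerivAt_angle t ht).hasDerivWithinAt) fun t ht => ?_
    rw [← NNReal.coe_le_coe, coe_nnnorm, Real.norm_eq_abs, NNReal.coe_mk]
    have h1 := hbG k t ht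
    have h2 := Real.abs_sin_le_one (θ k t)
    have h3 := Real.cos_sq_le_one (θ k t)
    have h4 := Real.sin_sq_le_one (θ k t)
    have h5 := mul_nonneg ((hadm k).nonneg t)
      (regCoeff_pos (p := p) (he0 k) (Real.exp (σ k t) * Real.sin (θ k t))).le
    set g := b (k + k₀) t * regCoeff p (e k) (Real.exp (σ k t) * Real.sin (θ k t))
    have h6 : g * Real.sin (θ k t) ^ 2 ≤ g * |Real.sin (θ k t)| := by
      rw [← sq_abs]
      gcongr
      nlinarith [abs_nonneg (Real.sin (θ k t))]
    have h7 : |lam * Real.sin (θ k t) ^ 2| ≤ |lam| := by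
      rw [abs_mul, abs_of_nonneg (sq_nonneg (Real.sin (θ k t)))]
      exact mul_le_of_le_one_right (abs_nonneg _) h4
    have h8 := mul_nonneg h5 (sq_nonneg (Real.sin (θ k t)))
    rw [abs_le] at h7 ⊢
    constructor <;> nlinarith [sq_nonneg (Real.cos (θ k t))]
  have hlipσ : ∀ k, LipschitzOnWith (.mk K hK0) (σ k) (Icc 0 L) := by
    intro k
    refine (convex_Icc 0 L).lipschitzOnWith_of_nnnorm_hasDerivWithin_le
      (fun t ht => ((hsol k).hasDerivAt_logRadius t ht).hasDerivWithinAt) fun t ht => ?_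
    rw [← NNReal.coe_le_coe, coe_nnnorm, Real.norm_eq_abs, NNReal.coe_mk]
    have h1 := hbG k t ht
    have h2 := Real.abs_sin_le_one (θ k t)
    have h3 := Real.abs_cos_le_one (θ k t)
    have h5 := mul_nonneg ((hadm k).nonneg t)
      (regCoeff_pos (p := p) (he0 k) (Real.exp (σ k t) * Real.sin (θ k t))).le
    set g := b (k + k₀) t * regCoeff p (e k) (Real.exp (σ k t) * Real.sin (θ k t))
    have h6 : |Real.sin (θ k t) * Real.cos (θ k t) * (1 - lam)| ≤ 1 * 1 * (1 + |lam|) := by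
      rw [abs_mul, abs_mul]
      gcongr
      refine (abs_sub _ _).trans ?_
      rw [abs_one]
    have h7 : |Real.cos (θ k t) * (g * Real.sin (θ k t))| ≤
        1 * (A * regModulus p (Real.exp M) * Real.exp (-m)) := by
      rw [abs_mul, abs_mul, abs_of_nonneg h5]
      gcongr
    calc _ = |Real.sin (θ k t) * Real.cos (θ k t) * (1 - lam) -
          Real.cos (θ k t) * (g * Real.sin (θ k t))| := by congr 1; ring
      _ ≤ _ := abs_sub _ _
      _ ≤ K := by linarith
  have hθmem : ∀ k, ∀ t ∈ Icc 0 L, θ k t ∈ Icc 0 (n * Real.pi) := fun k t ht =>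
    ⟨by simpa using (hsol k).isPrufer.int_mul_pi_le (j := 0) le_rfl ht.1 ht.2
          (by simp [(hsol k).angle_zero]),
      by simpa using (hsol k).isPrufer.le_int_mul_pi (j := n) ht.1 ht.2 le_rfl
          (by simp [hθL k])⟩
  obtain ⟨φ, hφ, g, hg, hlim⟩ := exists_subseq_tendsto_of_lipschitzOnWith hL.le
    ((isCompact_Icc (a := (0 : ℝ)) (b := n * Real.pi)).prod (isCompact_Icc (a := m) (b := M)))
    (f := fun k t => (θ k t, σ k t)) (fun k => (hlipθ k).prodMk (hlipσ k))
    (fun k t ht => ⟨hθmem k t ht, hσ k t ht⟩)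
  have hθlim : ∀ t ∈ Icc 0 L, Tendsto (fun k => θ (φ k) t) atTop (𝓝 (g t).1) := fun t ht =>
    (continuous_fst.tendsto _).comp (hlim t ht)
  have hσlim : ∀ t ∈ Icc 0 L, Tendsto (fun k => σ (φ k) t) atTop (𝓝 (g t).2) := fun t ht =>
    (continuous_snd.tendsto _).comp (hlim t ht)
  have hulim : ∀ t ∈ Icc 0 L, Tendsto (fun k => Real.exp (σ (φ k) t) * Real.sin (θ (φ k) t)) atTop
      (𝓝 (Real.exp (g t).2 * Real.sin (g t).1)) := fun t ht =>
    (Real.continuous_exp.tendsto _ |>.comp (hσlim t ht)).mul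
      (Real.continuous_sin.tendsto _ |>.comp (hθlim t ht))
  have hvlim : ∀ t ∈ Icc 0 L, Tendsto (fun k => Real.exp (σ (φ k) t) * Real.cos (θ (φ k) t)) atTop
      (𝓝 (Real.exp (g t).2 * Real.cos (g t).1)) := fun t ht =>
    (Real.continuous_exp.tendsto _ |>.comp (hσlim t ht)).mul
      (Real.continuous_cos.tendsto _ |>.comp (hθlim t ht))
  have hcu : ∀ k, ContinuousOn (fun t => Real.exp (σ k t) * Real.sin (θ k t)) (Icc 0 L) :=
    fun k t ht => ((hsol k).hasDerivAt_fst ht).continuousAt.continuousWithinAt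
  have hcv : ∀ k, ContinuousOn (fun t => Real.exp (σ k t) * Real.cos (θ k t)) (Icc 0 L) :=
    fun k t ht => ((hsol k).hasDerivAt_snd ht).continuousAt.continuousWithinAt
  have h0mem : (0 : ℝ) ∈ Icc 0 L := ⟨le_rfl, hL.le⟩
  refine ⟨fun t => (g t).1, fun t => (g t).2, continuous_fst.comp hg, continuous_snd.comp hg,
    ?_, ?_, fun x hx => ⟨?_, ?_⟩⟩
  · refine tendsto_nhds_unique (hθlim 0 h0mem) ?_
    simp [(hsol _).angle_zero]
  · refine tendsto_nhds_unique (hθlim L ⟨hL.le, le_rfl⟩) ?_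
    simp [hθL]
  · have hsub : Icc 0 x ⊆ Icc 0 L := Icc_subset_Icc_right hx.2
    have heq : ∀ k, Real.exp (σ k x) * Real.sin (θ k x) =
        ∫ t in (0 : ℝ)..x, Real.exp (σ k t) * Real.cos (θ k t) := by
      intro k
      rw [intervalIntegral.integral_eq_sub_of_hasDerivAt
        (fun t ht => (hsol k).hasDerivAt_fst (hsub (by rwa [uIcc_of_le hx.1] at ht)))
        ((hcv k).mono (by rwa [uIcc_of_le hx.1])).intervalIntegrable]
      simp [(hsol k).angle_zero]
    refine tendsto_nhds_unique (hulim x hx) ?_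
    simp_rw [heq]
    refine intervalIntegral.tendsto_integral_filter_of_dominated_convergence
      (fun _ => Real.exp M) (Eventually.of_forall fun k => ?_)
      (Eventually.of_forall fun k => Eventually.of_forall fun t ht => ?_)
      intervalIntegrable_const (Eventually.of_forall fun t ht => ?_)
    · rw [uIoc_of_le hx.1]
      exact ((hcv _).mono (Ioc_subset_Icc_self.trans hsub)).aestronglyMeasurable measurableSet_Ioc
    · rw [uIoc_of_le hx.1] at ht
      rw [norm_mul, Real.norm_of_nonneg (Real.exp_pos _).le]
      calc _ ≤ Real.exp M * 1 := by
            gcongr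
            · exact (hσ _ t (hsub ⟨ht.1.le, ht.2⟩)).2
            · exact Real.abs_cos_le_one _
        _ = _ := mul_one _
    · rw [uIoc_of_le hx.1] at ht
      exact hvlim t (hsub ⟨ht.1.le, ht.2⟩)
  · have hsub : Icc 0 x ⊆ Icc 0 L := Icc_subset_Icc_right hx.2
    have hcf : ∀ k, ContinuousOn (fun t => lam * (Real.exp (σ k t) * Real.sin (θ k t)) +
        b (k + k₀) t * (regCoeff p (e k) (Real.exp (σ k t) * Real.sin (θ k t)) *
          (Real.exp (σ k t) * Real.sin (θ k t)))) (Icc 0 L) := fun k =>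
      (continuousOn_const.mul (hcu k)).add ((hbc _).continuousOn.mul
        (((contDiff_regCoeff (he0 k)).continuous.comp_continuousOn (hcu k)).mul (hcu k)))
    have heq : ∀ k, Real.exp (σ k x) * Real.cos (θ k x) = Real.exp (σ k 0) * Real.cos (θ k 0) -
        ∫ t in (0 : ℝ)..x, (lam * (Real.exp (σ k t) * Real.sin (θ k t)) +
          b (k + k₀) t * (regCoeff p (e k) (Real.exp (σ k t) * Real.sin (θ k t)) *
            (Real.exp (σ k t) * Real.sin (θ k t)))) := by
      intro k
      have h1 := intervalIntegral.integral_eq_sub_of_hasDerivAt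
        (fun t ht => ((hsol k).hasDerivAt_snd
          (hsub (by rwa [uIcc_of_le hx.1] at ht))).neg.congr_deriv
          (show _ = lam * (Real.exp (σ k t) * Real.sin (θ k t)) +
            b (k + k₀) t * (regCoeff p (e k) (Real.exp (σ k t) * Real.sin (θ k t)) *
              (Real.exp (σ k t) * Real.sin (θ k t))) by ring))
        ((hcf k).mono (by rwa [uIcc_of_le hx.1])).intervalIntegrable
      rw [h1]
      simp only [Pi.neg_apply]
      ring
    refine tendsto_nhds_unique (hvlim x hx) ?_
    simp_rw [heq]
    refine (hvlim 0 h0mem).sub ?_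
    refine intervalIntegral.tendsto_integral_filter_of_dominated_convergence
      (fun _ => |lam| * Real.exp M + A * regModulus p (Real.exp M))
      (Eventually.of_forall fun k => ?_)
      (Eventually.of_forall fun k => Eventually.of_forall fun t ht => ?_)
      intervalIntegrable_const ?_
    · rw [uIoc_of_le hx.1]
      exact ((hcf _).mono (Ioc_subset_Icc_self.trans hsub)).aestronglyMeasurable measurableSet_Ioc
    · rw [uIoc_of_le hx.1] at ht
      have ht' := hsub ⟨ht.1.le, ht.2⟩
      refine (norm_add_le _ _).trans (add_le_add ?_ ?_)
      · rw [norm_mul]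
        exact mul_le_mul_of_nonneg_left (hu_le _ t ht') (norm_nonneg _)
      · rw [norm_mul, norm_mul, Real.norm_of_nonneg ((hadm _).nonneg t),
          Real.norm_of_nonneg (regCoeff_pos (he0 _) _).le]
        exact hΦ _ t ht'
    · filter_upwards [hblim] with t hbt ht
      rw [uIoc_of_le hx.1] at ht
      have h1 := hulim t (hsub ⟨ht.1.le, ht.2⟩)
      have h2 := tendsto_regCoeff_mul hp (helim.comp hφ.tendsto_atTop)
        (Eventually.of_forall fun k => he0 (φ k)) h1
      have h3 : Tendsto (fun k => b (φ k + k₀) t) atTop (𝓝 (a t)) :=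
        hbt.comp (tendsto_atTop_mono (fun k => Nat.le_add_right _ _) hφ.tendsto_atTop)
      exact (h1.const_mul lam).add (h3.mul h2)

/-! ### Existence of nodal solutions -/

lemma continuous_abs_rpow_sub_one_mul {p : ℝ} (hp : 0 < p) :
    Continuous fun w : ℝ => |w| ^ (p - 1) * w := by
  rw [continuous_iff_continuousAt]
  intro x
  rcases eq_or_ne x 0 with rfl | hne
  · have hnorm : ∀ w : ℝ, ‖|w| ^ (p - 1) * w‖ = |w| ^ p := fun w => by
      rw [norm_mul, Real.norm_of_nonneg (by positivity), Real.norm_eq_abs]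
      rcases eq_or_ne w 0 with rfl | hw
      · simp [Real.zero_rpow hp.ne']
      · rw [Real.rpow_sub_one (abs_pos.2 hw).ne']
        have := abs_pos.2 hw
        field_simp
    have h0 : Tendsto (fun w : ℝ => |w| ^ p) (𝓝 0) (𝓝 0) := by
      have : Continuous fun w : ℝ => |w| ^ p := continuous_abs.rpow_const fun _ => Or.inr hp.le
      simpa [Real.zero_rpow hp.ne'] using this.tendsto 0
    have h1 := squeeze_zero_norm (fun w => (hnorm w).le) h0
    simpa [ContinuousAt] using h1
  · exact (continuousAt_id.abs.rpow_const (Or.inl (abs_pos.2 hne).ne')).mul continuousAt_id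

lemma AbsolutelyContinuousOnInterval.congr_uIcc {f g : ℝ → ℝ} {x y : ℝ}
    (hf : AbsolutelyContinuousOnInterval f x y) (hfg : EqOn f g (uIcc x y)) :
    AbsolutelyContinuousOnInterval g x y := by
  rw [absolutelyContinuousOnInterval_iff] at hf ⊢
  intro ε hε
  obtain ⟨δ, hδ, H⟩ := hf ε hε
  refine ⟨δ, hδ, fun E hE hlt => ?_⟩
  convert H E hE hlt using 1
  refine Finset.sum_congr rfl fun i hi => ?_
  have hi' := hE.1 i hi
  rw [hfg hi'.1, hfg hi'.2]

theorem exists_isNodalSolution {lam L A a₀ h p : ℝ} {n : ℕ} {a : ℝ → ℝ} (hp : 0 < p)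
    (hp1 : p ≠ 1) (hh : 0 < h) (hhL : h ≤ L) (ha₀ : 0 < a₀) (hn : 1 ≤ n)
    (hlam : lam < (n * Real.pi / L) ^ 2) (hm : AEStronglyMeasurable a volume)
    (ha : IsAdmissibleWeight A a₀ h a) :
    ∃ u, IsNodalSolution L p a lam (n - 1) u ∧ 0 < derivOn L u 0 := by
  have hL : 0 < L := hh.trans_le hhL
  obtain ⟨θ, σ, hθ, hσ, hθ0, hθL, hint⟩ :=
    exists_prufer_integral_solution hp hp1 hh hhL ha₀ hn hlam hm ha
  set u : ℝ → ℝ := fun t => Real.exp (σ t) * Real.sin (θ t) with hu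
  set v : ℝ → ℝ := fun t => Real.exp (σ t) * Real.cos (θ t) with hv
  have huc : Continuous u := by fun_prop
  have hvc : Continuous v := by fun_prop
  set f : ℝ → ℝ := fun t => lam * u t + a t * (|u t| ^ (p - 1) * u t) with hf
  have hfi : IntervalIntegrable f volume 0 L :=
    (Continuous.intervalIntegrable (by fun_prop) 0 L).add
      ((ha.intervalIntegrable hm 0 L).mul_continuousOn
        ((continuous_abs_rpow_sub_one_mul hp).comp huc).continuousOn)
  have hderiv : ∀ x ∈ Icc 0 L, HasDerivWithinAt u (v x) (Icc 0 L) x := by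
    intro x hx
    have h1 : HasDerivAt (fun x => ∫ t in (0 : ℝ)..x, v t) (v x) x :=
      hvc.integral_hasStrictDerivAt 0 x |>.hasDerivAt
    exact h1.hasDerivWithinAt.congr (fun y hy => (hint y hy).1) (hint x hx).1
  have hud : UniqueDiffOn ℝ (Icc 0 L) := uniqueDiffOn_Icc hL
  have hderivOn : EqOn (derivOn L u) v (Icc 0 L) := fun x hx =>
    (hderiv x hx).derivWithin (hud x hx)
  have hv_eq : ∀ x ∈ Icc 0 L, v x = v 0 - ∫ t in (0 : ℝ)..x, f t := fun x hx => (hint x hx).2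
  have hprufer : IsPrufer L θ σ := ⟨hθ.continuousOn, hσ.continuousOn, hderiv⟩
  refine ⟨u, ⟨⟨?_, ?_, ?_, ?_, ?_⟩, hprufer.hasInteriorNodes hL hθ0 hθL⟩, ?_⟩
  · rw [contDiffOn_one_iff_derivWithin hud]
    exact ⟨fun x hx => (hderiv x hx).differentiableWithinAt, hvc.continuousOn.congr hderivOn⟩
  · have h1 : AbsolutelyContinuousOnInterval (fun x => -∫ t in (0 : ℝ)..x, f t) 0 L :=
      (hfi.absolutelyContinuousOnInterval_intervalIntegral (c := 0) (by simp)).neg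
    have h2 : AbsolutelyContinuousOnInterval (fun _ : ℝ => v 0) 0 L :=
      (LipschitzWith.const (v 0)).lipschitzOnWith.absolutelyContinuousOnInterval
    refine (h2.add h1).congr_uIcc fun x hx => ?_
    rw [uIcc_of_le hL.le] at hx
    rw [hderivOn hx, hv_eq x hx]
    simp [sub_eq_add_neg]
  · filter_upwards [hfi.ae_hasDerivAt_integral] with x hx hxL
    have hxL' : x ∈ Icc 0 L := Ioo_subset_Icc_self hxL
    have h1 := ((hx (by rwa [uIcc_of_le hL.le]) 0 (by simp)).const_sub (v 0))
    refine h1.congr_of_eventuallyEq ?_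
    filter_upwards [Ioo_mem_nhds hxL.1 hxL.2] with y hy
    rw [hderivOn (Ioo_subset_Icc_self hy), hv_eq y (Ioo_subset_Icc_self hy)]
  · simp [hu, hθ0]
  · simp [hu, hθL, Real.sin_nat_mul_pi]
  · rw [hderivOn ⟨le_rfl, hL.le⟩]
    simp [hv, hθ0, Real.exp_pos]

/-! ### Symmetry and dependence on the weight -/

namespace IsDirichletSolution

variable {L p lam : ℝ} {a b u : ℝ → ℝ}

lemma neg (hu : IsDirichletSolution L p a lam u) : IsDirichletSolution L p a lam (-u) := by
  have hd : derivOn L (-u) = -derivOn L u := by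
    ext x
    exact derivWithin.neg
  refine ⟨hu.contDiffOn.neg, ?_, ?_, by simp [hu.left_eq], by simp [hu.right_eq]⟩
  · rw [hd]
    exact hu.absolutelyContinuous.neg
  · rw [hd]
    filter_upwards [hu.equation] with x hx hxL
    refine (hx hxL).neg.congr_deriv ?_
    simp only [Pi.neg_apply, abs_neg]
    ring

lemma congr_weight (hu : IsDirichletSolution L p a lam u) (hab : EqOn a b (Icc 0 L)) :
    IsDirichletSolution L p b lam u := by
  refine ⟨hu.contDiffOn, hu.absolutelyContinuous, ?_, hu.left_eq, hu.right_eq⟩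
  filter_upwards [hu.equation] with x hx hxL
  rw [← hab (Ioo_subset_Icc_self hxL)]
  exact hx hxL

end IsDirichletSolution

lemma IsNodalSolution.neg {L p lam : ℝ} {a u : ℝ → ℝ} {k : ℕ}
    (hu : IsNodalSolution L p a lam k u) : IsNodalSolution L p a lam k (-u) := by
  refine ⟨hu.1.neg, ?_⟩
  have := hu.2
  unfold HasInteriorNodes at this ⊢
  simpa using this

/-! ### Necessity: Sturm comparison with the sine -/

namespace IsDirichletSolution

variable {L p lam : ℝ} {a u : ℝ → ℝ}

lemma hasDerivAt (hu : IsDirichletSolution L p a lam u) {x : ℝ} (hx : x ∈ Ioo 0 L) :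
    HasDerivAt u (derivOn L u x) x :=
  (hu.contDiffOn.differentiableOn one_ne_zero x
    (Ioo_subset_Icc_self hx)).hasDerivWithinAt.hasDerivAt (Icc_mem_nhds hx.1 hx.2)

/-- Integrating the equation against `sin (π (x - α) / (β - α))` over an interval `(α, β)` between
zeros of a positive `u` gives `∫ ((lam - ω ^ 2) u + a |u| ^ (p - 1) u) sin = 0` with
`ω = π / (β - α)`, and the integrand is nonnegative for `lam ≥ ω ^ 2`. -/
lemma ae_eq_zero_of_pos (hu : IsDirichletSolution L p a lam u) (ha : ∀ x, 0 ≤ a x) {α β : ℝ}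
    (hα : 0 ≤ α) (hαβ : α < β) (hβ : β ≤ L) (huα : u α = 0) (huβ : u β = 0)
    (hpos : ∀ x ∈ Ioo α β, 0 < u x) (hlam : (Real.pi / (β - α)) ^ 2 ≤ lam) :
    ∀ᵐ x, x ∈ Ioo α β →
      (lam - (Real.pi / (β - α)) ^ 2) * u x + a x * (|u x| ^ (p - 1) * u x) = 0 := by
  set ω := Real.pi / (β - α) with hω
  have hβα : 0 < β - α := sub_pos.2 hαβ
  have hω0 : 0 < ω := div_pos Real.pi_pos hβα
  have hωβ : ω * (β - α) = Real.pi := div_mul_cancel₀ _ hβα.ne'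
  have hL : 0 < L := hα.trans_lt (hαβ.trans_le hβ)
  set v := derivOn L u
  have hsub : uIcc α β ⊆ uIcc 0 L := by
    rw [uIcc_of_le hαβ.le, uIcc_of_le hL.le]
    exact Icc_subset_Icc hα hβ
  have huAC : AbsolutelyContinuousOnInterval u α β := by
    refine (ContDiffOn.absolutelyContinuousOnInterval ?_).mono hsub
    rw [uIcc_of_le hL.le]
    exact hu.contDiffOn
  have hvAC : AbsolutelyContinuousOnInterval v α β := hu.absolutelyContinuous.mono hsub
  have hsAC : AbsolutelyContinuousOnInterval (fun x => Real.sin (ω * (x - α))) α β :=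
    ContDiffOn.absolutelyContinuousOnInterval (ContDiff.contDiffOn (by fun_prop))
  have hcAC : AbsolutelyContinuousOnInterval (fun x => ω * Real.cos (ω * (x - α))) α β :=
    ContDiffOn.absolutelyContinuousOnInterval (ContDiff.contDiffOn (by fun_prop))
  set W : ℝ → ℝ := u * (fun x => ω * Real.cos (ω * (x - α))) -
    v * (fun x => Real.sin (ω * (x - α))) with hW
  have hWAC : AbsolutelyContinuousOnInterval W α β := (huAC.mul hcAC).sub (hvAC.mul hsAC)
  have hWint : ∫ x in α..β, deriv W x = 0 := by
    rw [hWAC.integral_deriv_eq_sub]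
    simp [hW, huα, huβ, hωβ]
  have hWd : ∀ᵐ x, x ∈ Ioo α β → deriv W x =
      ((lam - ω ^ 2) * u x + a x * (|u x| ^ (p - 1) * u x)) * Real.sin (ω * (x - α)) := by
    filter_upwards [hu.equation] with x hx hxm
    have hxL : x ∈ Ioo 0 L := ⟨hα.trans_lt hxm.1, hxm.2.trans_le hβ⟩
    have h0 : HasDerivAt (fun x => ω * (x - α)) ω x := by
      simpa using ((hasDerivAt_id x).sub_const α).const_mul ω
    have h1 := ((hu.hasDerivAt hxL).mul (h0.cos.const_mul ω)).sub ((hx hxL).mul h0.sin)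
    rw [h1.deriv]
    ring
  have hsin : ∀ x ∈ Ioo α β, 0 < Real.sin (ω * (x - α)) := fun x hx => by
    refine Real.sin_pos_of_pos_of_lt_pi (mul_pos hω0 (sub_pos.2 hx.1)) ?_
    rw [← hωβ]
    exact mul_lt_mul_of_pos_left (by linarith [hx.2]) hω0
  have hIoo : ∀ᵐ x ∂(volume.restrict (Ioc α β)), x ∈ Ioo α β := by
    rw [← Measure.restrict_congr_set Ioo_ae_eq_Ioc]
    exact ae_restrict_mem measurableSet_Ioo
  have hnn : 0 ≤ᵐ[volume.restrict (Ioc α β)] deriv W := by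
    filter_upwards [ae_restrict_of_ae hWd, hIoo] with x hx hxm
    rw [hx hxm]
    have h1 := (hpos x hxm).le
    have h2 := ha x
    have h3 := sub_nonneg.2 hlam
    have h4 := (hsin x hxm).le
    simp only [Pi.zero_apply]
    positivity
  have hz := (intervalIntegral.integral_eq_zero_iff_of_le_of_nonneg_ae hαβ.le hnn
    hWAC.intervalIntegrable_deriv).1 hWint
  rw [EventuallyEq, ae_restrict_iff' measurableSet_Ioc] at hz
  filter_upwards [hWd, hz] with x hx hxz hxm
  have h1 := hxz (Ioo_subset_Ioc_self hxm)
  rw [hx hxm] at h1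
  exact (mul_eq_zero.1 h1).resolve_right (hsin x hxm).ne'

/-- Sturm comparison on a nodal interval. It is strict on the first one, because the weight is
positive on `[0, h]`. -/
lemma lam_le_of_nodal_interval (hu : IsDirichletSolution L p a lam u) {A a₀ h : ℝ} (hh : 0 < h)
    (ha₀ : 0 < a₀) (ha : IsAdmissibleWeight A a₀ h a) {α β : ℝ}
    (hα : 0 ≤ α) (hαβ : α < β) (hβ : β ≤ L) (huα : u α = 0) (huβ : u β = 0)
    (hne : ∀ x ∈ Ioo α β, u x ≠ 0) :
    lam ≤ (Real.pi / (β - α)) ^ 2 ∧ (α = 0 → lam < (Real.pi / (β - α)) ^ 2) := by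
  wlog hpos : ∀ x ∈ Ioo α β, 0 < u x generalizing u
  · refine this hu.neg (by simp [huα]) (by simp [huβ]) (fun x hx => by simp [hne x hx]) ?_
    have hcont : ContinuousOn u (Ioo α β) :=
      hu.contDiffOn.continuousOn.mono
        (Ioo_subset_Icc_self.trans (Icc_subset_Icc hα hβ))
    push Not at hpos
    obtain ⟨y, hy, hy0⟩ := hpos
    intro x hx
    by_contra! hcon
    have hx0 : 0 ≤ u x := by simpa using hcon
    obtain ⟨w, hw, hw0⟩ := isPreconnected_Ioo.intermediate_value hy hx hcont ⟨hy0, hx0⟩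
    exact hne w hw hw0
  -- A nonempty interval where the nonnegative integrand is positive contradicts its vanishing.
  have key : (Real.pi / (β - α)) ^ 2 ≤ lam → ∀ γ ∈ Ioc α β, (∀ x ∈ Ioo α γ,
      0 < (lam - (Real.pi / (β - α)) ^ 2) * u x + a x * (|u x| ^ (p - 1) * u x)) → False := by
    intro hlam γ hγ hgt
    have h1 := hu.ae_eq_zero_of_pos ha.nonneg hα hαβ hβ huα huβ hpos hlam
    have h2 : ∀ᵐ x, x ∉ Ioo α γ := by
      filter_upwards [h1] with x hx hxm
      exact (hgt x hxm).ne' (hx ⟨hxm.1, hxm.2.trans_le hγ.2⟩)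
    have h3 : volume (Ioo α γ) = 0 := by
      rw [measure_eq_zero_iff_ae_notMem]
      exact h2
    rw [Real.volume_Ioo, ENNReal.ofReal_eq_zero] at h3
    linarith [hγ.1]
  constructor
  · by_contra! hlt
    refine key hlt.le β ⟨hαβ, le_rfl⟩ fun x hx => ?_
    have h1 := hpos x hx
    have h2 := ha.nonneg x
    have h3 := mul_pos (sub_pos.2 hlt) h1
    positivity
  · intro hα0
    by_contra! hle
    refine key hle (min β h) ⟨lt_min hαβ (hα0 ▸ hh), min_le_left _ _⟩ fun x hx => ?_
    have h1 := hpos x ⟨hx.1, hx.2.trans_le (min_le_left _ _)⟩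
    have h2 := ha₀.trans_le (ha.le_of_mem x
      ⟨hα.trans hx.1.le, (hx.2.trans_le (min_le_right _ _)).le⟩)
    have h3 := mul_nonneg (sub_nonneg.2 hle) h1.le
    positivity

/-- The first zero after an interval `(z, z + l)` without zeros. -/
lemma exists_next_zero (hu : IsDirichletSolution L p a lam u) {z l : ℝ} (hz : 0 ≤ z)
    (hl : 0 < l) (hzl : z + l ≤ L) (hne : ∀ x ∈ Ioo z (z + l), u x ≠ 0) :
    ∃ β ∈ Icc (z + l) L, u β = 0 ∧ ∀ x ∈ Ioo z β, u x ≠ 0 := by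
  set T := Icc (z + l) L ∩ u ⁻¹' {0}
  have hTc : IsClosed T := (hu.contDiffOn.continuousOn.mono
    (Icc_subset_Icc (by linarith) le_rfl)).preimage_isClosed_of_isClosed isClosed_Icc
    isClosed_singleton
  have hTb : BddBelow T := ⟨z + l, fun x hx => hx.1.1⟩
  have hm := hTc.csInf_mem ⟨L, ⟨hzl, le_rfl⟩, hu.right_eq⟩ hTb
  refine ⟨sInf T, hm.1, hm.2, fun x hx hx0 => ?_⟩
  rcases lt_or_ge x (z + l) with hlt | hge
  · exact hne x ⟨hx.1, hlt⟩ hx0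
  · exact absurd (csInf_le hTb (show x ∈ T from ⟨⟨hge, hx.2.le.trans hm.1.2⟩, hx0⟩))
      (not_le.2 hx.2)

/-- If `lam` is at least the `n`-th eigenvalue, then every solution has at least `n` interior
zeros, one more in each additional piece of length `L / n`. -/
lemma exists_finset_zeros (hu : IsDirichletSolution L p a lam u) {A a₀ h : ℝ} (hh : 0 < h)
    (hL : 0 < L) (ha₀ : 0 < a₀) (ha : IsAdmissibleWeight A a₀ h a) {n : ℕ} (hn : 1 ≤ n)
    (hlam : (n * Real.pi / L) ^ 2 ≤ lam) (j : ℕ) (hj : 1 ≤ j) (hjn : j ≤ n) :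
    ∃ F : Finset ℝ, F.card = j ∧ (∀ x ∈ F, x ∈ Ioo 0 L ∧ u x = 0) ∧
      ∃ z ∈ F, z < j * (L / n) ∧ ∀ x ∈ F, x ≤ z := by
  have hn' : (0 : ℝ) < n := by exact_mod_cast hn
  set l := L / n with hl_def
  have hl : 0 < l := by positivity
  have hnl : n * l = L := by rw [hl_def]; field_simp
  have hlam' : (Real.pi / l) ^ 2 ≤ lam := by
    convert hlam using 2
    rw [hl_def]; field_simp
  have hsq : ∀ d, l ≤ d → (Real.pi / d) ^ 2 ≤ (Real.pi / l) ^ 2 := fun d hd => by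
    have := Real.pi_pos
    have := hl.trans_le hd
    gcongr
  induction j, hj using Nat.le_induction with
  | base =>
    have hlL : l ≤ L := by
      rw [← hnl]
      have : (1 : ℝ) ≤ n := by exact_mod_cast hn
      nlinarith
    obtain ⟨z, hz, hz0⟩ : ∃ z ∈ Ioo 0 l, u z = 0 := by
      by_contra! hcon
      obtain ⟨β, hβ, huβ, hne⟩ := hu.exists_next_zero le_rfl hl (by linarith)
        (by simpa using hcon)
      have h1 := (hu.lam_le_of_nodal_interval hh ha₀ ha le_rfl (by linarith [hβ.1]) hβ.2 hu.left_eq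
        huβ hne).2 rfl
      linarith [hsq (β - 0) (by linarith [hβ.1])]
    exact ⟨{z}, by simp, by simpa using ⟨⟨hz.1, hz.2.trans_le hlL⟩, hz0⟩, z, by simp,
      by simpa using hz.2, by simp⟩
  | succ j hj ih =>
    obtain ⟨F, hcard, hF, z, hzF, hzl, hmax⟩ := ih (by omega)
    obtain ⟨hzm, hz0⟩ := hF z hzF
    have hjn' : (j + 1 : ℝ) ≤ n := by exact_mod_cast hjn
    have hzL : z + l < L := by
      rw [← hnl]
      nlinarith
    obtain ⟨w, hw, hw0⟩ : ∃ w ∈ Ioc z (z + l), u w = 0 := by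
      by_contra! hcon
      obtain ⟨β, hβ, huβ, hne⟩ := hu.exists_next_zero hzm.1.le hl hzL.le
        fun x hx => hcon x (Ioo_subset_Ioc_self hx)
      have hlt : z + l < β := lt_of_le_of_ne hβ.1 fun he =>
        hcon (z + l) ⟨by linarith, le_rfl⟩ (he ▸ huβ)
      have h1 := (hu.lam_le_of_nodal_interval hh ha₀ ha hzm.1.le (by linarith) hβ.2 hz0
        huβ hne).1
      have h2 : (Real.pi / (β - z)) ^ 2 < (Real.pi / l) ^ 2 := by
        have := Real.pi_pos
        have : l < β - z := by linarith
        have : 0 < β - z := by linarith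
        gcongr
      linarith
    have hwF : w ∉ F := fun hwF => absurd (hmax w hwF) (not_le.2 hw.1)
    refine ⟨insert w F, by rw [Finset.card_insert_of_notMem hwF, hcard], ?_, w, by simp, ?_, ?_⟩
    · intro x hx
      rcases Finset.mem_insert.1 hx with rfl | hx
      · exact ⟨⟨hzm.1.trans hw.1, hw.2.trans_lt hzL⟩, hw0⟩
      · exact hF x hx
    · push_cast
      linarith [hw.2]
    · intro x hx
      rcases Finset.mem_insert.1 hx with rfl | hx
      · exact le_rfl
      · exact (hmax x hx).trans hw.1.le

end IsDirichletSolution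

theorem IsNodalSolution.lam_lt {L p lam A a₀ h : ℝ} {a u : ℝ → ℝ} {n : ℕ}
    (hu : IsNodalSolution L p a lam (n - 1) u) (hh : 0 < h) (hL : 0 < L) (ha₀ : 0 < a₀)
    (ha : IsAdmissibleWeight A a₀ h a) (hn : 1 ≤ n) : lam < (n * Real.pi / L) ^ 2 := by
  by_contra! hle
  obtain ⟨F, hcard, hF, -⟩ := hu.1.exists_finset_zeros hh hL ha₀ ha hn hle n hn le_rfl
  have h1 : (F : Set ℝ) ⊆ {x ∈ Ioo 0 L | u x = 0} := fun x hx => hF x hx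
  have h2 := encard_le_encard h1
  rw [hu.2, Set.encard_coe_eq_coe_finsetCard, hcard] at h2
  have h3 : n ≤ n - 1 := by exact_mod_cast h2
  omega

/-! ### The weight of the problem -/

namespace IsHumpWeight

variable {L : ℝ} {m : ℕ} {t s : Fin (m + 1) → ℝ} {a : ℝ → ℝ}

lemma monotone_left (ha : IsHumpWeight L m t s a) : Monotone t :=
  (Fin.strictMono_iff_lt_succ.2 fun i => (ha.hump_lt i.castSucc).trans (ha.gap_lt i)).monotone

lemma monotone_right (ha : IsHumpWeight L m t s a) : Monotone s :=
  (Fin.strictMono_iff_lt_succ.2 fun i => (ha.gap_lt i).trans (ha.hump_lt i.succ)).monotone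

lemma hump_subset (ha : IsHumpWeight L m t s a) (i : Fin (m + 1)) :
    Icc (t i) (s i) ⊆ Icc 0 L := by
  refine Icc_subset_Icc ?_ ?_
  · rw [← ha.start_eq]; exact ha.monotone_left (Fin.zero_le i)
  · rw [← ha.end_eq]; exact ha.monotone_right (Fin.le_last i)

lemma eq_zero_of_notMem_hump (ha : IsHumpWeight L m t s a) {x : ℝ} (hx : x ∈ Icc 0 L)
    (hxn : ∀ i, x ∉ Icc (t i) (s i)) : a x = 0 := by
  obtain ⟨i, hi, hmax⟩ := (Finset.univ.filter fun i => t i ≤ x).exists_max_image id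
    ⟨0, by simp [ha.start_eq, hx.1]⟩
  have hi' : t i ≤ x := by simpa using hi
  have hsx : s i < x := by
    by_contra! hcon
    exact hxn i ⟨hi', hcon⟩
  have hlast : i ≠ Fin.last m := by
    rintro rfl
    rw [ha.end_eq] at hsx
    exact absurd hsx (not_lt.2 hx.2)
  obtain ⟨j, rfl⟩ := Fin.exists_castSucc_eq.2 hlast
  refine ha.zero_gap j x ⟨hsx, ?_⟩
  by_contra! hcon
  exact absurd (hmax j.succ (by simpa using hcon)) (not_le.2 (Fin.castSucc_lt_succ (i := j)))

/-- On `[0, L]` the weight agrees with a bounded measurable weight that is bounded below by a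
positive constant on the first hump. -/
lemma exists_admissible (ha : IsHumpWeight L m t s a) :
    ∃ (b : ℝ → ℝ) (A a₀ h : ℝ), 0 < h ∧ h ≤ L ∧ 0 < a₀ ∧ AEStronglyMeasurable b volume ∧
      IsAdmissibleWeight A a₀ h b ∧ EqOn b a (Icc 0 L) := by
  classical
  have hbdd : ∀ i, ∃ M, ∀ x ∈ Icc (t i) (s i), a x ≤ M := fun i => by
    obtain ⟨M, hM⟩ := isCompact_Icc.exists_bound_of_continuousOn (ha.continuousOn_hump i)
    exact ⟨M, fun x hx => (le_abs_self _).trans (hM x hx)⟩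
  choose M hM using hbdd
  obtain ⟨A, hA⟩ := (Set.finite_range M).bddAbove
  have hA' : ∀ i, M i ≤ A := fun i => hA ⟨i, rfl⟩
  have h0 : 0 < s 0 := by simpa [ha.start_eq] using ha.hump_lt 0
  have hne : (Icc (t 0) (s 0)).Nonempty := nonempty_Icc.2 (ha.hump_lt 0).le
  obtain ⟨y, hy, hmin⟩ := isCompact_Icc.exists_isMinOn hne (ha.continuousOn_hump 0)
  refine ⟨indicator (⋃ i, Icc (t i) (s i)) a, A, a y, s 0, h0, ?_, ha.pos_hump 0 y hy, ?_,
    ⟨fun x => ?_, fun x => ?_, fun x hx => ?_⟩, fun x hx => ?_⟩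
  · exact (ha.hump_subset 0 ⟨(ha.hump_lt 0).le, le_rfl⟩).2
  · rw [aestronglyMeasurable_indicator_iff (MeasurableSet.iUnion fun i => measurableSet_Icc),
      aestronglyMeasurable_iUnion_iff]
    exact fun i => (ha.continuousOn_hump i).aestronglyMeasurable measurableSet_Icc
  · rw [indicator_apply]
    split_ifs with hx
    · obtain ⟨i, hi⟩ := mem_iUnion.1 hx
      exact (ha.pos_hump i x hi).le
    · exact le_rfl
  · rw [indicator_apply]
    split_ifs with hx
    · obtain ⟨i, hi⟩ := mem_iUnion.1 hx
      exact (hM i x hi).trans (hA' i)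
    · exact (ha.pos_hump 0 y hy).le.trans ((hM 0 y hy).trans (hA' 0))
  · have hx' : x ∈ Icc (t 0) (s 0) := by rwa [ha.start_eq]
    rw [indicator_of_mem (mem_iUnion.2 ⟨0, hx'⟩)]
    exact hmin hx'
  · by_cases hmem : x ∈ ⋃ i, Icc (t i) (s i)
    · rw [indicator_of_mem hmem]
    · rw [indicator_of_notMem hmem,
        ha.eq_zero_of_notMem_hump hx fun i hi => hmem (mem_iUnion.2 ⟨i, hi⟩)]

end IsHumpWeight

/-! ### Number of nodal solutions -/

theorem theorem1p1 (L : ℝ) (m : ℕ) (t s : Fin (m + 1) → ℝ) (a : ℝ → ℝ)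
    (ha : IsHumpWeight L m t s a) (p : ℝ) (hp : 0 < p) (hp1 : p ≠ 1) :
    (∀ n : ℕ, 1 ≤ n → ∀ lam : ℝ,
      ((∃ u : ℝ → ℝ, IsNodalSolution L p a lam (n - 1) u) ↔ lam < dirichletEigenvalue L n) ∧
      (lam < dirichletEigenvalue L n →
        ∃ u : ℝ → ℝ, IsNodalSolution L p a lam (n - 1) u ∧ 0 < derivOn L u 0 ∧
          IsNodalSolution L p a lam (n - 1) (-u) ∧ ¬ EqOn u (-u) (Icc 0 L))) ∧
    (∀ lam : ℝ, lam < dirichletEigenvalue L 1 → ∀ κ : ℕ, 1 ≤ κ →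
      HasTwoNodalSolutions L p a lam (κ - 1)) ∧
    (∀ κ n : ℕ, 1 ≤ n → n ≤ κ →
      ∀ lam ∈ Ico (dirichletEigenvalue L n) (dirichletEigenvalue L (n + 1)),
        HasTwoNodalSolutions L p a lam κ) := by
  obtain ⟨b, A, a₀, h, hh, hhL, ha₀, hm, hb, hba⟩ := ha.exists_admissible
  have hL : 0 < L := hh.trans_le hhL
  have hex : ∀ n : ℕ, 1 ≤ n → ∀ lam : ℝ, lam < dirichletEigenvalue L n →
      ∃ u : ℝ → ℝ, IsNodalSolution L p a lam (n - 1) u ∧ 0 < derivOn L u 0 ∧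
        IsNodalSolution L p a lam (n - 1) (-u) ∧ ¬ EqOn u (-u) (Icc 0 L) := by
    intro n hn lam hlam
    obtain ⟨u, hu, hu0⟩ := exists_isNodalSolution hp hp1 hh hhL ha₀ hn hlam hm hb
    have hu' : IsNodalSolution L p a lam (n - 1) u := ⟨hu.1.congr_weight hba, hu.2⟩
    refine ⟨u, hu', hu0, hu'.neg, fun heq => ?_⟩
    have hzero : EqOn u (fun _ => 0) (Icc 0 L) := fun x hx => by
      have := heq hx
      simp only [Pi.neg_apply] at this
      linarith
    have h0 : (0 : ℝ) ∈ Icc 0 L := ⟨le_rfl, hL.le⟩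
    rw [derivOn, derivWithin_congr hzero (hzero h0)] at hu0
    simp at hu0
  have hmono : ∀ n k : ℕ, n ≤ k → dirichletEigenvalue L n ≤ dirichletEigenvalue L k := by
    intro n k hnk
    have : (n : ℝ) ≤ k := by exact_mod_cast hnk
    unfold dirichletEigenvalue
    have := Real.pi_pos
    gcongr
  refine ⟨fun n hn lam => ⟨⟨?_, fun hlam => ?_⟩, hex n hn lam⟩, fun lam hlam κ hκ => ?_,
    fun κ n hn hnκ lam hlam => ?_⟩
  · rintro ⟨u, hu⟩
    have hu' : IsNodalSolution L p b lam (n - 1) u := ⟨hu.1.congr_weight hba.symm, hu.2⟩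
    exact hu'.lam_lt hh hL ha₀ hb hn
  · obtain ⟨u, hu, -⟩ := hex n hn lam hlam
    exact ⟨u, hu⟩
  · obtain ⟨u, hu, -, hu', hne⟩ := hex κ hκ lam (hlam.trans_le (hmono 1 κ hκ))
    exact ⟨u, -u, hu, hu', hne⟩
  · obtain ⟨u, hu, -, hu', hne⟩ := hex (κ + 1) (by omega) lam
      (hlam.2.trans_le (hmono (n + 1) (κ + 1) (by omega)))
    exact ⟨u, -u, hu, hu', hne⟩
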